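/- Let $q\in\mathbb{C}\setminus\{0\}$ with $|q|\neq 1$, fix a square root $q^{1/2}$ of $q$, and write $[\tfrac12]_q=\frac{q^{1/2}-q^{-1/2}}{q-q^{-1}}$ and $\{X,Y\}_q=q^{1/2}XY+q^{-1/2}YX$. Let $\mathfrak{osp}_q(1|2)$ be the unital associative $\mathbb{C}$-algebra with generators $A_+,A_-,K,K^{-1},P$ and relations $$KA_\pm K^{-1}=q^{\pm1/2}A_\pm,\quad A_+A_-+A_-A_+=\frac{K^2-K^{-2}}{q^{1/2}-q^{-1/2}},\quad PA_\pm=-A_\pm P,\quad PK^{\pm1}=K^{\pm1}P,\quad KK^{-1}=K^{-1}K=1,\quad P^2=1,$$ with Casimir element $\Gamma^q=\left(-A_+A_-+\frac{q^{-1/2}K^2-q^{1/2}K^{-2}}{q-q^{-1}}\right)P$ and with coproduct $\Delta$ the algebra morphism given by $$\Delta(A_\pm)=A_\pm\otimes KP+K^{-1}\otimes A_\pm,\quad \Delta(K)=K\otimes K,\quad \Delta(P)=P\otimes P.$$ Tensor products carry the ungraded product $(a\otimes b)(a'\otimes b')=aa'\otimes bb'$. Let $\mathcal I\subset\mathfrak{osp}_q(1|2)$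 be the subalgebra generated by $A_-K$, $A_+K$, $K^2P$, $\Gamma^q$. It satisfies $\Delta(\mathcal I)\subset\mathfrak{osp}_q(1|2)\otimes\mathcal I$, and $\tau:\mathcal I\to\mathfrak{osp}_q(1|2)\otimes\mathcal I$ denotes the algebra morphism with $$\tau(A_-K)=K^2P\otimes A_-K,\qquad \tau(K^2P)=1\otimes K^2P-(q-q^{-1})A_+K\otimes A_-K,\qquad \tau(\Gamma^q)=1\otimes\Gamma^q,$$ $$\tau(A_+K)=K^{-2}P\otimes A_+K+q^{-1/2}(q-q^{-1})A_+^2P\otimes A_-K+q^{-1/2}(q^{1/2}-q^{-1/2})A_+K^{-1}P\otimes K^2P+q^{-1/2}(q-q^{-1})A_+K^{-1}P\otimes\Gamma^q.$$ For nonempty $A\subseteq[n]=\{1,\dots,n\}$ define $\Gamma_A^q\in\mathfrak{osp}_q(1|2)^{\otimes n}$ by applying to $\Gamma^q$ successively, for $k=\min A+1,\dots,\max A$, the morphism $$\tau^A_{k-1,k}=\begin{cases}1^{\otimes(k-\min A-1)}\otimes\Delta & k-1\in A,\ k\in A,\\ (1^{\otimes(k-\min A)}\otimes\tau)(1^{\otimes(k-\min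 A-1)}\otimes\Delta)& k-1\in A,\ k\notin A,\\ 1^{\otimes(k-\min A-1)}\otimes\Delta\otimes1& k-1\notin A,\ k\notin A,\\ \mathrm{id}& k-1\notin A,\ k\in A,\end{cases}$$ and then adding $\min A-1$ tensor factors $1$ in front and $n-\max A$ tensor factors $1$ at the end; put $\Gamma_\emptyset^q=-[\tfrac12]_q$. We say that $A$ *matches* $B$ if $A\setminus B$, $A\cap B$, $B\setminus A$ are nonempty and $\max(A\setminus B)<\min(A\cap B)$, $\max(A\cap B)<\min(B\setminus A)$. **Theorem.** Let $A,B\subseteq[n]$ be such that $A$ matches $B$ and $A$ is a set of consecutive integers, and let $C=(A\cup B)\setminus(A\cap B)$. Then $\Gamma_A^q,\Gamma_B^q,\Gamma_C^q$ generate a rank 1 $q$-Bannai–Ito algebra: $$\begin{aligned}\{\Gamma_A^q,\Gamma_B^q\}_q&=\Gamma_C^q+(q^{1/2}+q^{-1/2})\left(\Gamma_{A\cap B}^q\Gamma_{A\cup B}^q+\Gamma_{A\setminus(A\cap B)}^q\Gamma_{B\setminus(A\cap B)}^q\right),\\ \{\Gamma_B^q,\Gamma_C^q\}_q&=\Gamma_A^q+(q^{1/2}+q^{-1/2})\left(\Gamma_{B\cap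 C}^q\Gamma_{B\cup C}^q+\Gamma_{B\setminus(B\cap C)}^q\Gamma_{C\setminus(B\cap C)}^q\right),\\ \{\Gamma_C^q,\Gamma_A^q\}_q&=\Gamma_B^q+(q^{1/2}+q^{-1/2})\left(\Gamma_{C\cap A}^q\Gamma_{C\cup A}^q+\Gamma_{C\setminus(C\cap A)}^q\Gamma_{A\setminus(C\cap A)}^q\right),\end{aligned}$$ and the three structure terms $(q^{1/2}+q^{-1/2})(\cdots)$ on the right-hand sides commute with every element of the algebra generated by $\Gamma_A^q,\Gamma_B^q,\Gamma_C^q$. -/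

import Mathlib

open scoped TensorProduct
set_option linter.unusedSimpArgs false
set_option linter.unnecessarySeqFocus false

namespace QBI

/-- The deformation parameter `q ∈ ℂ`, `q ≠ 0`, `|q| ≠ 1`, together with an arbitrary choice
`s = q^{1/2}` of a square root of `q`. -/
structure QParam where
  q : ℂ
  s : ℂ
  sq_s : s ^ 2 = q
  q_ne_zero : q ≠ 0
  norm_q_ne_one : ‖q‖ ≠ 1

theorem QParam.s_ne_zero (Q : QParam) : Q.s ≠ 0 := by
  intro h
  apply Q.q_ne_zero
  rw [← Q.sq_s, h]; norm_num

theorem QParam.neg_q_pow_ne_one (Q : QParam) (m : ℕ) (hm : m ≠ 0) : (-Q.q) ^ m ≠ 1 := by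
  intro h
  have h2 : ‖Q.q‖ ^ m = 1 := by
    have := congrArg norm h
    simpa using this
  exact Q.norm_q_ne_one ((pow_eq_one_iff_of_nonneg (norm_nonneg _) hm).1 h2)

theorem QParam.q_ne_neg_one (Q : QParam) : Q.q ≠ -1 := by
  intro h
  apply Q.norm_q_ne_one
  rw [h]; simp

theorem QParam.q_ne_one (Q : QParam) : Q.q ≠ 1 := by
  intro h
  apply Q.norm_q_ne_one
  rw [h]; simp

/-- The generators `A_+`, `A_-`, `K`, `K⁻¹`, `P`. -/
inductive Gen
  | Ap | Am | K | Ki | P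

/-- The defining relations of `osp_q(1|2)`. -/
inductive Rel (Q : QParam) : FreeAlgebra ℂ Gen → FreeAlgebra ℂ Gen → Prop
  | K_Ki : Rel Q (.ι ℂ .K * .ι ℂ .Ki) 1
  | Ki_K : Rel Q (.ι ℂ .Ki * .ι ℂ .K) 1
  | K_Ap : Rel Q (.ι ℂ .K * .ι ℂ .Ap * .ι ℂ .Ki) (Q.s • .ι ℂ .Ap)
  | K_Am : Rel Q (.ι ℂ .K * .ι ℂ .Am * .ι ℂ .Ki) (Q.s⁻¹ • .ι ℂ .Am)
  | Ap_Am : Rel Q (.ι ℂ .Ap * .ι ℂ .Am + .ι ℂ .Am * .ι ℂ .Ap)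
      ((Q.s - Q.s⁻¹)⁻¹ • (.ι ℂ .K ^ 2 - .ι ℂ .Ki ^ 2))
  | P_Ap : Rel Q (.ι ℂ .P * .ι ℂ .Ap + .ι ℂ .Ap * .ι ℂ .P) 0
  | P_Am : Rel Q (.ι ℂ .P * .ι ℂ .Am + .ι ℂ .Am * .ι ℂ .P) 0
  | P_K : Rel Q (.ι ℂ .P * .ι ℂ .K) (.ι ℂ .K * .ι ℂ .P)
  | P_Ki : Rel Q (.ι ℂ .P * .ι ℂ .Ki) (.ι ℂ .Ki * .ι ℂ .P)
  | P_P : Rel Q (.ι ℂ .P ^ 2) 1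

/-- The quantum superalgebra `osp_q(1|2)`. -/
def Osp (Q : QParam) : Type := RingQuot (Rel Q)

noncomputable instance (Q : QParam) : Ring (Osp Q) := inferInstanceAs (Ring (RingQuot (Rel Q)))
noncomputable instance (Q : QParam) : Algebra ℂ (Osp Q) :=
  inferInstanceAs (Algebra ℂ (RingQuot (Rel Q)))

/-- The image of a generator in `osp_q(1|2)`. -/
noncomputable def gen (Q : QParam) (g : Gen) : Osp Q :=
  RingQuot.mkAlgHom ℂ (Rel Q) (FreeAlgebra.ι ℂ g)

theorem gen_rel (Q : QParam) {x y : FreeAlgebra ℂ Gen} (h : Rel Q x y) :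
    FreeAlgebra.lift ℂ (gen Q) x = FreeAlgebra.lift ℂ (gen Q) y := by
  have e : FreeAlgebra.lift ℂ (gen Q) = RingQuot.mkAlgHom ℂ (Rel Q) := by
    ext g; simp [gen]; rfl
  rw [e]
  exact RingQuot.mkAlgHom_rel ℂ h

/-- The universal property of `osp_q(1|2)`. -/
noncomputable def ospLift (Q : QParam) {B : Type} [Ring B] [Algebra ℂ B] (f : Gen → B)
    (h : ∀ x y, Rel Q x y → FreeAlgebra.lift ℂ f x = FreeAlgebra.lift ℂ f y) : Osp Q →ₐ[ℂ] B :=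
  RingQuot.liftAlgHom ℂ ⟨FreeAlgebra.lift ℂ f, fun x y => h x y⟩

theorem ospLift_gen (Q : QParam) {B : Type} [Ring B] [Algebra ℂ B] (f : Gen → B)
    (h : ∀ x y, Rel Q x y → FreeAlgebra.lift ℂ f x = FreeAlgebra.lift ℂ f y) (g : Gen) :
    ospLift Q f h (gen Q g) = f g := by
  unfold ospLift gen
  erw [RingQuot.liftAlgHom_mkAlgHom_apply]
  simp

noncomputable abbrev Ap (Q : QParam) : Osp Q := gen Q .Ap
noncomputable abbrev Am (Q : QParam) : Osp Q := gen Q .Am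
noncomputable abbrev K (Q : QParam) : Osp Q := gen Q .K
noncomputable abbrev Ki (Q : QParam) : Osp Q := gen Q .Ki
noncomputable abbrev P (Q : QParam) : Osp Q := gen Q .P

section normal
variable (Q : QParam)

theorem K_Ki : K Q * Ki Q = 1 := by simpa using gen_rel Q Rel.K_Ki
theorem Ki_K : Ki Q * K Q = 1 := by simpa using gen_rel Q Rel.Ki_K
theorem K_Ap : K Q * Ap Q = Q.s • (Ap Q * K Q) := by
  have h : K Q * Ap Q * Ki Q = Q.s • Ap Q := by simpa using gen_rel Q Rel.K_Ap
  rw [← smul_mul_assoc, ← h, mul_assoc, Ki_K, mul_one]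
theorem K_Am : K Q * Am Q = Q.s⁻¹ • (Am Q * K Q) := by
  have h : K Q * Am Q * Ki Q = Q.s⁻¹ • Am Q := by simpa using gen_rel Q Rel.K_Am
  rw [← smul_mul_assoc, ← h, mul_assoc, Ki_K, mul_one]
theorem Ki_Ap : Ki Q * Ap Q = Q.s⁻¹ • (Ap Q * Ki Q) := by
  have h : Ki Q * (K Q * Ap Q) * Ki Q = Ki Q * (Q.s • (Ap Q * K Q)) * Ki Q := by rw [K_Ap]
  rw [← mul_assoc, Ki_K, one_mul] at h
  rw [h, mul_smul_comm, smul_mul_assoc, smul_smul, inv_mul_cancel₀ Q.s_ne_zero, one_smul]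
  simp only [mul_assoc, K_Ki, mul_one]
theorem Ki_Am : Ki Q * Am Q = Q.s • (Am Q * Ki Q) := by
  have h : Ki Q * (K Q * Am Q) * Ki Q = Ki Q * (Q.s⁻¹ • (Am Q * K Q)) * Ki Q := by rw [K_Am]
  rw [← mul_assoc, Ki_K, one_mul] at h
  rw [h, mul_smul_comm, smul_mul_assoc, smul_smul, mul_inv_cancel₀ Q.s_ne_zero, one_smul]
  simp only [mul_assoc, K_Ki, mul_one]
theorem Am_Ap : Am Q * Ap Q =
    (Q.s - Q.s⁻¹)⁻¹ • (K Q * K Q - Ki Q * Ki Q) - Ap Q * Am Q := by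
  have h : Ap Q * Am Q + Am Q * Ap Q = (Q.s - Q.s⁻¹)⁻¹ • (K Q ^ 2 - Ki Q ^ 2) := by
    simpa using gen_rel Q Rel.Ap_Am
  rw [← pow_two, ← pow_two, ← h]; abel
theorem P_Ap : P Q * Ap Q = - (Ap Q * P Q) := by
  have h : P Q * Ap Q + Ap Q * P Q = 0 := by simpa using gen_rel Q Rel.P_Ap
  exact eq_neg_of_add_eq_zero_left h
theorem P_Am : P Q * Am Q = - (Am Q * P Q) := by
  have h : P Q * Am Q + Am Q * P Q = 0 := by simpa using gen_rel Q Rel.P_Am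
  exact eq_neg_of_add_eq_zero_left h
theorem P_K : P Q * K Q = K Q * P Q := by simpa using gen_rel Q Rel.P_K
theorem P_Ki : P Q * Ki Q = Ki Q * P Q := by simpa using gen_rel Q Rel.P_Ki
theorem P_P : P Q * P Q = 1 := by simpa [pow_two] using gen_rel Q Rel.P_P

theorem assoc_of {A : Type} [Ring A] {a b c : A} (h : a * b = c) (z : A) :
    a * (b * z) = c * z := by rw [← mul_assoc, h]


/-- Rewriting rules that bring a monomial in the order `A_+`, `A_-`, `K^{±1}`, `P`. -/
theorem osp_nf :
    (K Q * Ki Q = 1 ∧ Ki Q * K Q = 1 ∧ K Q * Ap Q = Q.s • (Ap Q * K Q) ∧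
      K Q * Am Q = Q.s⁻¹ • (Am Q * K Q) ∧ Ki Q * Ap Q = Q.s⁻¹ • (Ap Q * Ki Q) ∧
      Ki Q * Am Q = Q.s • (Am Q * Ki Q) ∧ P Q * Ap Q = - (Ap Q * P Q) ∧
      P Q * Am Q = - (Am Q * P Q) ∧ P Q * K Q = K Q * P Q ∧ P Q * Ki Q = Ki Q * P Q ∧
      P Q * P Q = 1 ∧ Am Q * Ap Q =
        (Q.s - Q.s⁻¹)⁻¹ • (K Q * K Q - Ki Q * Ki Q) - Ap Q * Am Q) ∧
    ∀ z : Osp Q, K Q * (Ki Q * z) = z ∧ Ki Q * (K Q * z) = z ∧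
      K Q * (Ap Q * z) = Q.s • (Ap Q * (K Q * z)) ∧
      K Q * (Am Q * z) = Q.s⁻¹ • (Am Q * (K Q * z)) ∧
      Ki Q * (Ap Q * z) = Q.s⁻¹ • (Ap Q * (Ki Q * z)) ∧
      Ki Q * (Am Q * z) = Q.s • (Am Q * (Ki Q * z)) ∧
      P Q * (Ap Q * z) = - (Ap Q * (P Q * z)) ∧ P Q * (Am Q * z) = - (Am Q * (P Q * z)) ∧
      P Q * (K Q * z) = K Q * (P Q * z) ∧ P Q * (Ki Q * z) = Ki Q * (P Q * z) ∧
      P Q * (P Q * z) = z ∧ Am Q * (Ap Q * z) =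
        (Q.s - Q.s⁻¹)⁻¹ • (K Q * (K Q * z) - Ki Q * (Ki Q * z)) - Ap Q * (Am Q * z) := by
  refine ⟨⟨K_Ki Q, Ki_K Q, K_Ap Q, K_Am Q, Ki_Ap Q, Ki_Am Q, P_Ap Q, P_Am Q, P_K Q, P_Ki Q,
    P_P Q, Am_Ap Q⟩, fun z => ⟨?_, ?_, ?_, ?_, ?_, ?_, ?_, ?_, ?_, ?_, ?_, ?_⟩⟩
  · rw [assoc_of (K_Ki Q), one_mul]
  · rw [assoc_of (Ki_K Q), one_mul]
  · rw [assoc_of (K_Ap Q), smul_mul_assoc, mul_assoc]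
  · rw [assoc_of (K_Am Q), smul_mul_assoc, mul_assoc]
  · rw [assoc_of (Ki_Ap Q), smul_mul_assoc, mul_assoc]
  · rw [assoc_of (Ki_Am Q), smul_mul_assoc, mul_assoc]
  · rw [assoc_of (P_Ap Q), neg_mul, mul_assoc]
  · rw [assoc_of (P_Am Q), neg_mul, mul_assoc]
  · rw [assoc_of (P_K Q), mul_assoc]
  · rw [assoc_of (P_Ki Q), mul_assoc]
  · rw [assoc_of (P_P Q), one_mul]
  · rw [assoc_of (Am_Ap Q), sub_mul, smul_mul_assoc, sub_mul, mul_assoc, mul_assoc, mul_assoc]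

end normal

section scalars
variable (Q : QParam)

theorem QParam.q_sub_ne_zero : Q.q - Q.q⁻¹ ≠ 0 := by
  intro h
  have h1 : Q.q ^ 2 = 1 := by
    have := Q.q_ne_zero
    field_simp at h
    linear_combination h
  rcases eq_or_eq_neg_of_sq_eq_sq _ _ (h1.trans (one_pow 2).symm) with h | h
  · exact Q.q_ne_one h
  · exact Q.q_ne_neg_one h

theorem QParam.s_sq_sub_one_ne_zero : Q.s ^ 2 - 1 ≠ 0 := by
  rw [Q.sq_s]; exact sub_ne_zero.2 Q.q_ne_one

theorem QParam.s_sq_add_one_ne_zero : Q.s ^ 2 + 1 ≠ 0 := by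
  rw [Q.sq_s]; intro h; exact Q.q_ne_neg_one (eq_neg_of_add_eq_zero_left h)

theorem QParam.s_sub_inv : Q.s - Q.s⁻¹ = (Q.s ^ 2 - 1) / Q.s := by
  have := Q.s_ne_zero
  field_simp

theorem QParam.q_sub_inv : Q.q - Q.q⁻¹ = (Q.s ^ 2 - 1) * (Q.s ^ 2 + 1) / Q.s ^ 2 := by
  have := Q.s_ne_zero
  rw [← Q.sq_s]
  field_simp
  ring

end scalars

/-- The Casimir element
`Γ^q = (-A_+ A_- + (q^{-1/2} K² - q^{1/2} K⁻²) / (q - q⁻¹)) P`. -/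
noncomputable def casimir (Q : QParam) : Osp Q :=
  (-(Ap Q * Am Q) + (Q.q - Q.q⁻¹)⁻¹ • (Q.s⁻¹ • K Q ^ 2 - Q.s • Ki Q ^ 2)) * P Q

section casimir
variable (Q : QParam)

theorem casimir_K : casimir Q * K Q = K Q * casimir Q := by
  have h := Q.s_ne_zero
  simp only [casimir, pow_two, mul_add, add_mul, mul_sub, sub_mul, mul_assoc, smul_mul_assoc,
    mul_smul_comm, smul_smul, smul_add, smul_sub, neg_mul, mul_neg, smul_neg, osp_nf, mul_one,
    mul_inv_cancel₀ h, inv_mul_cancel₀ h, one_smul]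

theorem casimir_Ki : casimir Q * Ki Q = Ki Q * casimir Q := by
  have h := Q.s_ne_zero
  simp only [casimir, pow_two, mul_add, add_mul, mul_sub, sub_mul, mul_assoc, smul_mul_assoc,
    mul_smul_comm, smul_smul, smul_add, smul_sub, neg_mul, mul_neg, smul_neg, osp_nf, mul_one,
    mul_inv_cancel₀ h, inv_mul_cancel₀ h, one_smul]

theorem casimir_P : casimir Q * P Q = P Q * casimir Q := by
  simp only [casimir, pow_two, mul_add, add_mul, mul_sub, sub_mul, mul_assoc, smul_mul_assoc,
    mul_smul_comm, smul_smul, smul_add, smul_sub, neg_mul, mul_neg, smul_neg, osp_nf, mul_one,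
    neg_neg]

theorem casimir_Ap : casimir Q * Ap Q = Ap Q * casimir Q := by
  have h := Q.s_ne_zero
  have h1 := Q.s_sq_sub_one_ne_zero
  have h2 := Q.s_sq_add_one_ne_zero
  simp only [casimir, pow_two, mul_add, add_mul, mul_sub, sub_mul, mul_assoc, smul_mul_assoc,
    mul_smul_comm, smul_smul, smul_add, smul_sub, neg_mul, mul_neg, smul_neg, osp_nf, mul_one,
    neg_neg, Q.q_sub_inv, Q.s_sub_inv]
  match_scalars <;> field_simp <;> ring

theorem casimir_Am : casimir Q * Am Q = Am Q * casimir Q := by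
  have h := Q.s_ne_zero
  have h1 := Q.s_sq_sub_one_ne_zero
  have h2 := Q.s_sq_add_one_ne_zero
  simp only [casimir, pow_two, mul_add, add_mul, mul_sub, sub_mul, mul_assoc, smul_mul_assoc,
    mul_smul_comm, smul_smul, smul_add, smul_sub, neg_mul, mul_neg, smul_neg, osp_nf, mul_one,
    neg_neg, Q.q_sub_inv, Q.s_sub_inv]
  match_scalars <;> field_simp <;> ring

end casimir

/-- The values of the coproduct on the generators. -/
noncomputable def comulGen (Q : QParam) : Gen → Osp Q ⊗[ℂ] Osp Q
  | .Ap => Ap Q ⊗ₜ (K Q * P Q) + Ki Q ⊗ₜ Ap Q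
  | .Am => Am Q ⊗ₜ (K Q * P Q) + Ki Q ⊗ₜ Am Q
  | .K => K Q ⊗ₜ K Q
  | .Ki => Ki Q ⊗ₜ Ki Q
  | .P => P Q ⊗ₜ P Q

open TensorProduct in
/-- The coproduct `Δ`, an algebra morphism into `osp ⊗ osp` with the product
`(a₁ ⊗ a₂)(b₁ ⊗ b₂) = a₁ b₁ ⊗ a₂ b₂`. -/
noncomputable def comul (Q : QParam) : Osp Q →ₐ[ℂ] Osp Q ⊗[ℂ] Osp Q :=
  ospLift Q (comulGen Q) (by
    have h := Q.s_ne_zero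
    have h1 := Q.s_sq_sub_one_ne_zero
    intro x y r
    cases r <;>
    simp only [map_mul, map_add, map_sub, map_neg, map_smul, map_pow, map_zero, map_one,
      FreeAlgebra.lift_ι_apply, comulGen, pow_two, mul_add, add_mul, Algebra.TensorProduct.tmul_mul_tmul,
      Algebra.TensorProduct.one_def, 
      mul_assoc, osp_nf, mul_neg, neg_mul, mul_smul_comm, smul_mul_assoc, mul_one, one_mul,
      ← smul_tmul', tmul_smul, tmul_neg, neg_tmul, smul_smul, smul_add, smul_sub, smul_neg, neg_neg, 
      mul_sub, sub_mul, tmul_sub, sub_tmul, tmul_add, add_tmul, mul_inv_cancel₀ h, inv_mul_cancel₀ h, one_smul, neg_smul] <;>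
    first | done | ((try simp only [Q.s_sub_inv]); match_scalars <;> (try field_simp) <;> ring))

section comul
variable (Q : QParam)

theorem comul_gen (g : Gen) : comul Q (gen Q g) = comulGen Q g := ospLift_gen Q _ _ g

/-- The elements `A_- K`, `A_+ K`, `K² P` of `osp_q(1|2)`. -/
noncomputable def xO : Osp Q := Am Q * K Q
noncomputable def yO : Osp Q := Ap Q * K Q
noncomputable def kO : Osp Q := K Q ^ 2 * P Q

/-- The subalgebra `𝓘` generated by `A_- K`, `A_+ K`, `K² P` and `Γ^q`. -/
noncomputable def subI : Subalgebra ℂ (Osp Q) := Algebra.adjoin ℂ {xO Q, yO Q, kO Q, casimir Q}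

/-- The four generators of `𝓘`, as elements of `𝓘`: `A_- K`, `A_+ K`, `K² P`, `Γ^q`. -/
noncomputable def xI : subI Q := ⟨xO Q, Algebra.subset_adjoin (by simp)⟩
noncomputable def yI : subI Q := ⟨yO Q, Algebra.subset_adjoin (by simp)⟩
noncomputable def kI : subI Q := ⟨kO Q, Algebra.subset_adjoin (by simp)⟩
noncomputable def casI : subI Q := ⟨casimir Q, Algebra.subset_adjoin (by simp)⟩

/-- The inclusion `W ⊗ 𝓘 → W ⊗ osp_q(1|2)`. -/
noncomputable def inclI (W : Type) [Ring W] [Algebra ℂ W] :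
    W ⊗[ℂ] subI Q →ₐ[ℂ] W ⊗[ℂ] Osp Q :=
  Algebra.TensorProduct.map (AlgHom.id ℂ W) (subI Q).val

theorem inclI_injective (W : Type) [Ring W] [Algebra ℂ W] : Function.Injective (inclI Q W) :=
  Module.Flat.lTensor_preserves_injective_linearMap (M := W) (subI Q).val.toLinearMap
    Subtype.val_injective

theorem inclI_tmul (W : Type) [Ring W] [Algebra ℂ W] (w : W) (z : subI Q) :
    inclI Q W (w ⊗ₜ z) = w ⊗ₜ (z : Osp Q) := by
  simp [inclI]

theorem comul_xO : comul Q (xO Q) = inclI Q (Osp Q) (xO Q ⊗ₜ kI Q + 1 ⊗ₜ xI Q) := by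
  simp only [map_add, inclI_tmul, kI, xI, xO, kO, map_mul, comul_gen, comulGen, add_mul,
    Algebra.TensorProduct.tmul_mul_tmul, osp_nf, mul_assoc, pow_two]

theorem comul_yO : comul Q (yO Q) = inclI Q (Osp Q) (yO Q ⊗ₜ kI Q + 1 ⊗ₜ yI Q) := by
  simp only [map_add, inclI_tmul, kI, yI, yO, kO, map_mul, comul_gen, comulGen, add_mul,
    Algebra.TensorProduct.tmul_mul_tmul, osp_nf, mul_assoc, pow_two]

theorem comul_kO : comul Q (kO Q) = inclI Q (Osp Q) (kO Q ⊗ₜ kI Q) := by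
  simp only [inclI_tmul, kI, kO, map_mul, comul_gen, comulGen,
    Algebra.TensorProduct.tmul_mul_tmul, mul_assoc, pow_two]

open TensorProduct in
theorem comul_casimir : comul Q (casimir Q) = inclI Q (Osp Q)
    (-(Q.s • ((Am Q * Ki Q * P Q) ⊗ₜ yI Q)) + Q.s⁻¹ • ((Ap Q * Ki Q * P Q) ⊗ₜ xI Q)
      + ((Q.s - Q.s⁻¹) / (Q.q - Q.q⁻¹)) • ((Ki Q ^ 2 * P Q) ⊗ₜ kI Q) + casimir Q ⊗ₜ kI Q
      + (Ki Q ^ 2 * P Q) ⊗ₜ casI Q) := by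
  have h := Q.s_ne_zero
  have h1 := Q.s_sq_sub_one_ne_zero
  have h2 := Q.s_sq_add_one_ne_zero
  simp only [map_add, map_neg, map_sub, map_smul, inclI_tmul, kI, yI, xI, casI, xO, yO, kO, casimir,
    map_mul, comul_gen, comulGen, mul_add, add_mul, pow_two,
    Algebra.TensorProduct.tmul_mul_tmul,
    mul_assoc, osp_nf, mul_neg, neg_mul, mul_smul_comm, smul_mul_assoc, mul_one, one_mul,
    ← smul_tmul', tmul_smul, tmul_neg, neg_tmul, smul_smul, smul_add, smul_sub, smul_neg, neg_neg,
    mul_sub, sub_mul, tmul_sub, sub_tmul, tmul_add, add_tmul, Q.s_sub_inv, Q.q_sub_inv]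
  match_scalars <;> field_simp <;> ring

theorem comul_mem (z : subI Q) : comul Q z ∈ (inclI Q (Osp Q)).range := by
  have : subI Q ≤ (inclI Q (Osp Q)).range.comap (comul Q) := by
    refine Algebra.adjoin_le ?_
    rintro z (rfl | rfl | rfl | rfl)
    · exact ⟨_, (comul_xO Q).symm⟩
    · exact ⟨_, (comul_yO Q).symm⟩
    · exact ⟨_, (comul_kO Q).symm⟩
    · exact ⟨_, (comul_casimir Q).symm⟩
  exact this z.2

/-- The restriction `Δ : 𝓘 → osp_q(1|2) ⊗ 𝓘` of the coproduct (`𝓘` is a left coideal). -/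
noncomputable def comulI : subI Q →ₐ[ℂ] Osp Q ⊗[ℂ] subI Q :=
  ((AlgEquiv.ofInjective (inclI Q (Osp Q)) (inclI_injective Q (Osp Q))).symm :
      (inclI Q (Osp Q)).range →ₐ[ℂ] Osp Q ⊗[ℂ] subI Q).comp
    (((comul Q).comp (subI Q).val).codRestrict _ (comul_mem Q))

theorem inclI_comulI (z : subI Q) : inclI Q (Osp Q) (comulI Q z) = comul Q z := by
  have := congrArg Subtype.val (AlgEquiv.apply_symm_apply
    (AlgEquiv.ofInjective (inclI Q (Osp Q)) (inclI_injective Q (Osp Q)))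
    (((comul Q).comp (subI Q).val).codRestrict _ (comul_mem Q) z))
  exact this

end comul

/-! Construction of the coaction `τ`, the algebra morphism `𝓘 → osp ⊗ 𝓘` that takes the values in
`tau_x`, `tau_y`, `tau_k`, `tau_casimir` below on the four generators of `𝓘`.  What precedes `tau`
shows that these values do extend to an algebra morphism.  Their first tensor legs lie in the image
of an auxiliary algebra with generators `a = A_+ K` and `u^{±1} = (K² P)^{±1}`. -/

inductive BGen
  | a | u | v

inductive BRel (Q : QParam) : FreeAlgebra ℂ BGen → FreeAlgebra ℂ BGen → Prop
  | u_v : BRel Q (.ι ℂ .u * .ι ℂ .v) 1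
  | v_u : BRel Q (.ι ℂ .v * .ι ℂ .u) 1
  | u_a : BRel Q (.ι ℂ .u * .ι ℂ .a) ((-Q.q) • (.ι ℂ .a * .ι ℂ .u))

def Bor (Q : QParam) : Type := RingQuot (BRel Q)

noncomputable instance (Q : QParam) : Ring (Bor Q) := inferInstanceAs (Ring (RingQuot (BRel Q)))
noncomputable instance (Q : QParam) : Algebra ℂ (Bor Q) :=
  inferInstanceAs (Algebra ℂ (RingQuot (BRel Q)))

noncomputable def bgen (Q : QParam) (g : BGen) : Bor Q :=
  RingQuot.mkAlgHom ℂ (BRel Q) (FreeAlgebra.ι ℂ g)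

theorem bgen_lift (Q : QParam) :
    FreeAlgebra.lift ℂ (bgen Q) = RingQuot.mkAlgHom ℂ (BRel Q) := by
  ext g; simp [bgen]; rfl

theorem bgen_rel (Q : QParam) {x y : FreeAlgebra ℂ BGen} (h : BRel Q x y) :
    FreeAlgebra.lift ℂ (bgen Q) x = FreeAlgebra.lift ℂ (bgen Q) y := by
  rw [bgen_lift]
  exact RingQuot.mkAlgHom_rel ℂ h

noncomputable def borLift (Q : QParam) {B : Type} [Ring B] [Algebra ℂ B] (f : BGen → B)
    (h : ∀ x y, BRel Q x y → FreeAlgebra.lift ℂ f x = FreeAlgebra.lift ℂ f y) : Bor Q →ₐ[ℂ] B :=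
  RingQuot.liftAlgHom ℂ ⟨FreeAlgebra.lift ℂ f, fun x y => h x y⟩

theorem borLift_gen (Q : QParam) {B : Type} [Ring B] [Algebra ℂ B] (f : BGen → B)
    (h : ∀ x y, BRel Q x y → FreeAlgebra.lift ℂ f x = FreeAlgebra.lift ℂ f y) (g : BGen) :
    borLift Q f h (bgen Q g) = f g := by
  unfold borLift bgen
  erw [RingQuot.liftAlgHom_mkAlgHom_apply]
  simp

theorem bor_induction (Q : QParam) {p : Bor Q → Prop} (hc : ∀ c : ℂ, p (algebraMap ℂ _ c))
    (hg : ∀ g, p (bgen Q g)) (hm : ∀ x y, p x → p y → p (x * y))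
    (ha : ∀ x y, p x → p y → p (x + y)) (z : Bor Q) : p z := by
  obtain ⟨w, hw⟩ := RingQuot.mkAlgHom_surjective ℂ (BRel Q) z
  have key : ∀ w, p (FreeAlgebra.lift ℂ (bgen Q) w) := by
    intro w
    induction w using FreeAlgebra.induction with
    | grade0 r => simpa using hc r
    | grade1 g => simpa using hg g
    | mul a b iha ihb => rw [map_mul]; exact hm _ _ iha ihb
    | add a b iha ihb => rw [map_add]; exact ha _ _ iha ihb
  have := key w
  rw [bgen_lift] at this
  rw [← hw]; exact this

section coaction
variable (Q : QParam)

theorem bor_u_v : bgen Q .u * bgen Q .v = 1 := by simpa using bgen_rel Q BRel.u_v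
theorem bor_v_u : bgen Q .v * bgen Q .u = 1 := by simpa using bgen_rel Q BRel.v_u
theorem bor_u_a : bgen Q .u * bgen Q .a = (-Q.q) • (bgen Q .a * bgen Q .u) := by
  simpa using bgen_rel Q BRel.u_a
theorem bor_a_v : bgen Q .a * bgen Q .v = (-Q.q) • (bgen Q .v * bgen Q .a) := by
  have h : bgen Q .v * (bgen Q .u * bgen Q .a) * bgen Q .v =
    bgen Q .v * ((-Q.q) • (bgen Q .a * bgen Q .u)) * bgen Q .v := by rw [bor_u_a]
  rw [← mul_assoc, bor_v_u, one_mul] at h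
  rw [h, mul_smul_comm, smul_mul_assoc]
  simp only [mul_assoc, bor_u_v, mul_one]

theorem bor_u_pow (m : ℕ) :
    bgen Q .u * bgen Q .a ^ m = (-Q.q) ^ m • (bgen Q .a ^ m * bgen Q .u) := by
  induction m with
  | zero => simp
  | succ m ih =>
    rw [pow_succ, ← mul_assoc, ih, smul_mul_assoc, mul_assoc, bor_u_a, mul_smul_comm, smul_smul,
      ← pow_succ, mul_assoc]

theorem bor_pow_v (m : ℕ) :
    bgen Q .a ^ m * bgen Q .v = (-Q.q) ^ m • (bgen Q .v * bgen Q .a ^ m) := by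
  induction m with
  | zero => simp
  | succ m ih =>
    rw [pow_succ, mul_assoc, bor_a_v, mul_smul_comm, ← mul_assoc, ih, smul_mul_assoc, smul_smul,
      mul_assoc, pow_succ, mul_comm (-Q.q)]

/-- `a ↦ A_+ K`, `u ↦ K² P`, `v ↦ K⁻² P`. -/
noncomputable def borToOsp : Bor Q →ₐ[ℂ] Osp Q :=
  borLift Q (fun g => match g with
    | .a => yO Q
    | .u => kO Q
    | .v => Ki Q ^ 2 * P Q) (by
    intro x y r
    cases r <;>
    simp only [map_mul, map_smul, map_one, FreeAlgebra.lift_ι_apply, yO, kO, pow_two, mul_assoc,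
      osp_nf, mul_smul_comm, smul_mul_assoc, smul_smul, neg_smul, mul_neg, mul_one, ← Q.sq_s,
      smul_neg, map_neg])

/-- The untwisted version `A_- ↦ u ⊗ A_-`, `A_+ ↦ v ⊗ A_+`, `K ↦ 1 ⊗ K`, `P ↦ 1 ⊗ P`. -/
noncomputable def phi : Osp Q →ₐ[ℂ] Bor Q ⊗[ℂ] Osp Q :=
  ospLift Q (fun g => match g with
    | .Ap => bgen Q .v ⊗ₜ Ap Q
    | .Am => bgen Q .u ⊗ₜ Am Q
    | .K => 1 ⊗ₜ K Q
    | .Ki => 1 ⊗ₜ Ki Q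
    | .P => 1 ⊗ₜ P Q) (by
    intro x y r
    have h := Q.s_ne_zero
    cases r <;>
    simp only [map_mul, map_add, map_sub, map_smul, map_one, map_zero, FreeAlgebra.lift_ι_apply,
      pow_two, mul_assoc, Algebra.TensorProduct.tmul_mul_tmul, Algebra.TensorProduct.one_def,
      osp_nf, mul_smul_comm, smul_mul_assoc, smul_smul, neg_smul, mul_neg, mul_one, one_mul,
      TensorProduct.tmul_smul, TensorProduct.tmul_neg, TensorProduct.tmul_sub,
      inv_mul_cancel₀ h, mul_inv_cancel₀ h, one_smul, bor_u_v, bor_v_u, neg_add_cancel,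
      add_sub_cancel])

theorem phi_gen (g : Gen) : phi Q (gen Q g) = match g with
    | .Ap => bgen Q .v ⊗ₜ Ap Q
    | .Am => bgen Q .u ⊗ₜ Am Q
    | .K => 1 ⊗ₜ K Q
    | .Ki => 1 ⊗ₜ Ki Q
    | .P => 1 ⊗ₜ P Q := ospLift_gen Q _ _ g

theorem phi_xO : phi Q (xO Q) = bgen Q .u ⊗ₜ xO Q := by
  simp only [xO, map_mul, phi_gen, Algebra.TensorProduct.tmul_mul_tmul, mul_one]
theorem phi_yO : phi Q (yO Q) = bgen Q .v ⊗ₜ yO Q := by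
  simp only [yO, map_mul, phi_gen, Algebra.TensorProduct.tmul_mul_tmul, mul_one]
theorem phi_kO : phi Q (kO Q) = 1 ⊗ₜ kO Q := by
  simp only [kO, pow_two, map_mul, phi_gen, Algebra.TensorProduct.tmul_mul_tmul, mul_one]
theorem phi_casimir : phi Q (casimir Q) = 1 ⊗ₜ casimir Q := by
  simp only [casimir, pow_two, map_mul, map_add, map_sub, map_neg, map_smul, phi_gen,
    Algebra.TensorProduct.tmul_mul_tmul, mul_one, bor_v_u, TensorProduct.tmul_smul,
    TensorProduct.tmul_neg, TensorProduct.tmul_sub, TensorProduct.tmul_add,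
    add_mul, sub_mul, smul_mul_assoc, neg_mul, smul_sub]

/-- `w = A_- K (K² P)⁻¹` -/
noncomputable def wO : Osp Q := Am Q * Ki Q * P Q
noncomputable def kiO : Osp Q := Ki Q ^ 2 * P Q

theorem w_x : wO Q * xO Q = (-Q.q) • (xO Q * wO Q) := by
  simp only [wO, xO, kO, kiO, pow_two, mul_assoc, osp_nf, mul_smul_comm, smul_mul_assoc,
    smul_smul, neg_smul, mul_neg, mul_one, ← Q.sq_s, smul_neg, neg_mul]
  match_scalars <;> have h := Q.s_ne_zero <;> field_simp
theorem w_k : wO Q * kO Q = (-Q.q) • (kO Q * wO Q) := by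
  simp only [wO, xO, kO, kiO, pow_two, mul_assoc, osp_nf, mul_smul_comm, smul_mul_assoc,
    smul_smul, neg_smul, mul_neg, mul_one, ← Q.sq_s, smul_neg, neg_mul]
  match_scalars <;> have h := Q.s_ne_zero <;> field_simp
theorem w_ki : wO Q * kiO Q = (-Q.q)⁻¹ • (kiO Q * wO Q) := by
  simp only [wO, xO, kO, kiO, pow_two, mul_assoc, osp_nf, mul_smul_comm, smul_mul_assoc,
    smul_smul, neg_smul, mul_neg, mul_one, ← Q.sq_s, smul_neg, neg_mul]
  match_scalars <;> have h := Q.s_ne_zero <;> field_simp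
theorem x_eq : xO Q = (-Q.q) • (kO Q * wO Q) := by
  simp only [wO, xO, kO, kiO, pow_two, mul_assoc, osp_nf, mul_smul_comm, smul_mul_assoc,
    smul_smul, neg_smul, mul_neg, mul_one, ← Q.sq_s, smul_neg, neg_mul]
  match_scalars <;> have h := Q.s_ne_zero <;> field_simp
theorem y_w : yO Q * wO Q =
    (Q.q - Q.q⁻¹)⁻¹ • (Q.q⁻¹ • kO Q - kiO Q) - Q.s⁻¹ • casimir Q := by
  have h := Q.s_ne_zero
  have h1 := Q.s_sq_sub_one_ne_zero
  have h2 := Q.s_sq_add_one_ne_zero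
  simp only [casimir, yO, wO, xO, kO, kiO, pow_two, mul_assoc, osp_nf, mul_smul_comm, smul_mul_assoc,
    smul_smul, neg_smul, mul_neg, mul_one, smul_neg, neg_mul, Q.q_sub_inv,
    smul_sub, smul_add, add_mul, sub_mul]
  simp only [← Q.sq_s]
  match_scalars <;> field_simp <;> ring
theorem w_y : wO Q * yO Q = yO Q * wO Q - (Q.s ^ 2 - 1)⁻¹ • (kO Q - kiO Q) := by
  have h := Q.s_ne_zero
  have h1 := Q.s_sq_sub_one_ne_zero
  have h2 := Q.s_sq_add_one_ne_zero
  simp only [casimir, yO, wO, xO, kO, kiO, pow_two, mul_assoc, osp_nf, mul_smul_comm, smul_mul_assoc,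
    smul_smul, neg_smul, mul_neg, mul_one, smul_neg, neg_mul, Q.s_sub_inv,
    smul_sub, smul_add, add_mul, sub_mul, mul_sub]
  match_scalars <;> field_simp

theorem w_pow_k (m : ℕ) : wO Q ^ m * kO Q = (-Q.q) ^ m • (kO Q * wO Q ^ m) := by
  induction m with
  | zero => simp
  | succ m ih =>
    rw [pow_succ, mul_assoc, w_k, mul_smul_comm, ← mul_assoc, ih, smul_mul_assoc, smul_smul,
      mul_assoc, pow_succ, mul_comm (-Q.q)]

theorem w_pow_x (m : ℕ) : wO Q ^ m * xO Q = (-Q.q) ^ m • (xO Q * wO Q ^ m) := by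
  induction m with
  | zero => simp
  | succ m ih =>
    rw [pow_succ, mul_assoc, w_x, mul_smul_comm, ← mul_assoc, ih, smul_mul_assoc, smul_smul,
      mul_assoc, pow_succ, mul_comm (-Q.q)]

theorem casimir_w (m : ℕ) : wO Q ^ m * casimir Q = casimir Q * wO Q ^ m := by
  have h : Commute (casimir Q) (wO Q) :=
    ((show Commute (casimir Q) (Am Q) from casimir_Am Q).mul_right (casimir_Ki Q)).mul_right
      (casimir_P Q)
  exact (h.pow_right m).eq.symm

theorem w_pow_y (m : ℕ) : wO Q ^ (m + 1) * yO Q = yO Q * wO Q ^ (m + 1) -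
    ((Q.s ^ 2 - 1)⁻¹ * (((-Q.q) ^ (m + 1) - 1) / (-Q.q - 1))) • (kO Q * wO Q ^ m) +
    ((Q.s ^ 2 - 1)⁻¹ * ((((-Q.q) ^ (m + 1))⁻¹ - 1) / ((-Q.q)⁻¹ - 1))) • (kiO Q * wO Q ^ m) := by
  have h := Q.s_ne_zero
  have h1 := Q.s_sq_sub_one_ne_zero
  have h2 := Q.s_sq_add_one_ne_zero
  have h3 : -Q.s ^ 2 - 1 ≠ 0 := by
    intro h; apply h2; linear_combination -h
  have h4 : (-Q.s ^ 2)⁻¹ - 1 ≠ 0 := by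
    intro h; apply h2; field_simp at h; linear_combination -h
  induction m with
  | zero =>
    simp only [zero_add, pow_one, pow_zero, mul_one, w_y]
    simp only [← Q.sq_s]
    rw [div_self h3, div_self h4]
    module
  | succ m ih =>
    rw [pow_succ', mul_assoc, ih, mul_add, mul_sub, mul_smul_comm, mul_smul_comm, ← mul_assoc,
      ← mul_assoc, ← mul_assoc, w_k, w_ki, w_y, sub_mul, smul_mul_assoc, sub_mul, smul_mul_assoc,
      smul_mul_assoc]
    simp only [mul_assoc, ← pow_succ', smul_smul]
    simp only [← Q.sq_s]
    have hp : (-Q.s ^ 2) ^ m ≠ 0 := pow_ne_zero _ (neg_ne_zero.2 (pow_ne_zero _ h))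
    simp only [pow_succ (-Q.s ^ 2)]
    generalize (-Q.s ^ 2) ^ m = p at *
    have h5 : (-Q.s ^ 2)⁻¹ - 1 = (-Q.s ^ 2 - 1) / Q.s ^ 2 := by field_simp; ring
    have h6 : -Q.s ^ 2 - 1 = -(Q.s ^ 2 + 1) := by ring
    rw [h5, h6]
    match_scalars <;> field_simp <;> ring

/-- Coefficients of the intertwining series. -/
noncomputable def theta : ℕ → ℂ
  | 0 => 1
  | m + 1 => (Q.q - Q.q⁻¹) * Q.q / ((-Q.q) ^ (m + 1) - 1) * theta m

theorem theta_succ (m : ℕ) :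
    (Q.q ^ 2 - 1) * theta Q m = ((-Q.q) ^ (m + 1) - 1) * theta Q (m + 1) := by
  have h := sub_ne_zero.2 (Q.neg_q_pow_ne_one (m + 1) (Nat.succ_ne_zero m))
  have := Q.q_ne_zero
  rw [theta]
  field_simp

theorem leg_y (m : ℕ) : (theta Q (m + 1) * (-Q.q) ^ (m + 1)) • (wO Q ^ (m + 1) * yO Q) =
    theta Q (m + 1) • (yO Q * wO Q ^ (m + 1)) +
    (theta Q m * (-Q.q)) • ((Q.s⁻¹ * (Q.s - Q.s⁻¹)) • (kO Q * wO Q ^ m)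
      + (Q.s⁻¹ * (Q.q - Q.q⁻¹)) • (casimir Q * wO Q ^ m)) +
    (theta Q m * ((-Q.q) ^ (m + 1) + Q.q)) • (kO Q * wO Q ^ m) := by
  have h := Q.s_ne_zero
  have h1 := Q.s_sq_sub_one_ne_zero
  have h2 := Q.s_sq_add_one_ne_zero
  have h3 : (Q.s ^ 2) ^ 2 - 1 ≠ 0 := by
    have : (Q.s ^ 2) ^ 2 - 1 = (Q.s ^ 2 - 1) * (Q.s ^ 2 + 1) := by ring
    rw [this]; exact mul_ne_zero h1 h2
  have hm : theta Q m = ((-Q.q) ^ (m + 1) - 1) * theta Q (m + 1) / (Q.q ^ 2 - 1) := by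
    rw [← theta_succ, ← Q.sq_s, mul_div_cancel_left₀ _ h3]
  rw [hm, w_pow_y, pow_succ' (wO Q), ← mul_assoc, y_w]
  simp only [sub_mul, smul_mul_assoc, smul_sub, Q.q_sub_inv]
  simp only [← Q.sq_s]
  have hp : (-Q.s ^ 2) ^ (m + 1) ≠ 0 := pow_ne_zero _ (neg_ne_zero.2 (pow_ne_zero _ h))
  generalize (-Q.s ^ 2) ^ (m + 1) = p at *
  have h5 : (-Q.s ^ 2)⁻¹ - 1 = (-Q.s ^ 2 - 1) / Q.s ^ 2 := by field_simp; ring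
  have h6 : -Q.s ^ 2 - 1 = -(Q.s ^ 2 + 1) := by ring
  have h7 : (Q.s ^ 2) ^ 2 - 1 = (Q.s ^ 2 - 1) * (Q.s ^ 2 + 1) := by ring
  rw [h5, h6, h7]
  match_scalars <;> field_simp <;> ring

/-- The grading of the auxiliary algebra by the degree in `a`, recorded by a polynomial
variable. -/
noncomputable def gradeB : Bor Q →ₐ[ℂ] Polynomial (Bor Q ⊗[ℂ] Osp Q) :=
  borLift Q (fun g => match g with
    | .a => Polynomial.X * Polynomial.C (bgen Q .a ⊗ₜ 1)
    | .u => Polynomial.C (bgen Q .u ⊗ₜ 1)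
    | .v => Polynomial.C (bgen Q .v ⊗ₜ 1)) (by
    intro x y r
    cases r
    · simp only [map_mul, FreeAlgebra.lift_ι_apply, ← Polynomial.C_mul,
        Algebra.TensorProduct.tmul_mul_tmul, bor_u_v, mul_one, map_one]
      exact Polynomial.C_1
    · simp only [map_mul, FreeAlgebra.lift_ι_apply, ← Polynomial.C_mul,
        Algebra.TensorProduct.tmul_mul_tmul, bor_v_u, mul_one, map_one]
      exact Polynomial.C_1
    · simp only [map_mul, map_smul, FreeAlgebra.lift_ι_apply]
      rw [← mul_assoc, ← Polynomial.X_mul_C, mul_assoc, mul_assoc, ← Polynomial.C_mul,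
        ← Polynomial.C_mul, Algebra.TensorProduct.tmul_mul_tmul,
        Algebra.TensorProduct.tmul_mul_tmul, bor_u_a, ← TensorProduct.smul_tmul',
        ← Polynomial.smul_C, mul_smul_comm])

theorem gradeB_gen (g : BGen) : gradeB Q (bgen Q g) = match g with
    | .a => Polynomial.X * Polynomial.C (bgen Q .a ⊗ₜ 1)
    | .u => Polynomial.C (bgen Q .u ⊗ₜ 1)
    | .v => Polynomial.C (bgen Q .v ⊗ₜ 1) := borLift_gen Q _ _ g

theorem gradeB_commute (b : Bor Q) (z : Osp Q) :
    Commute (gradeB Q b)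
      ((Polynomial.CAlgHom.comp (Algebra.TensorProduct.includeRight (R := ℂ) (A := Bor Q))) z) := by
  have hc : ∀ b : Bor Q, Commute (Polynomial.C (b ⊗ₜ[ℂ] (1 : Osp Q)))
      (Polynomial.C ((1 : Bor Q) ⊗ₜ[ℂ] z)) := by
    intro b
    unfold Commute SemiconjBy
    rw [← Polynomial.C_mul, ← Polynomial.C_mul, Algebra.TensorProduct.tmul_mul_tmul,
      Algebra.TensorProduct.tmul_mul_tmul, one_mul, mul_one, one_mul, mul_one]
  change Commute (gradeB Q b) (Polynomial.C ((1 : Bor Q) ⊗ₜ[ℂ] z))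
  induction b using bor_induction with
  | hc c => rw [AlgHom.commutes]; exact Algebra.commute_algebraMap_left c _
  | hg g =>
    rw [gradeB_gen]
    cases g
    · exact (Polynomial.commute_X _).mul_left (hc _)
    · exact hc _
    · exact hc _
  | hm x y hx hy => rw [map_mul]; exact hx.mul_left hy
  | ha x y hx hy => rw [map_add]; exact hx.add_left hy

noncomputable def grade : Bor Q ⊗[ℂ] Osp Q →ₐ[ℂ] Polynomial (Bor Q ⊗[ℂ] Osp Q) :=
  Algebra.TensorProduct.lift (gradeB Q)
    (Polynomial.CAlgHom.comp (Algebra.TensorProduct.includeRight (R := ℂ) (A := Bor Q)))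
    (gradeB_commute Q)

theorem grade_tmul (b : Bor Q) (z : Osp Q) :
    grade Q (b ⊗ₜ z) = gradeB Q b * Polynomial.C (1 ⊗ₜ z) := rfl

theorem grade_injective : Function.Injective (grade Q) := by
  let ev : Polynomial (Bor Q ⊗[ℂ] Osp Q) →+* Bor Q ⊗[ℂ] Osp Q :=
    Polynomial.eval₂RingHom' (RingHom.id _) 1 (fun a => Commute.one_right _)
  have evC : ∀ r, ev (Polynomial.C r) = r := fun r => Polynomial.eval₂_C _ _
  have evX : ev Polynomial.X = 1 := Polynomial.eval₂_X _ _
  have hB : ∀ b : Bor Q, ev (gradeB Q b) = b ⊗ₜ 1 := by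
    intro b
    induction b using bor_induction with
    | hc c =>
      rw [AlgHom.commutes, Polynomial.algebraMap_apply, evC,
        Algebra.TensorProduct.algebraMap_apply]
    | hg g =>
      rw [gradeB_gen]
      cases g
      · simp only [map_mul, evX, evC, one_mul]
      · simp only [evC]
      · simp only [evC]
    | hm x y hx hy => rw [map_mul, map_mul, hx, hy, Algebra.TensorProduct.tmul_mul_tmul, one_mul]
    | ha x y hx hy => rw [map_add, map_add, hx, hy, TensorProduct.add_tmul]
  have hev : ∀ z, ev (grade Q z) = z := by
    intro z
    induction z using TensorProduct.induction_on with
    | zero => rw [map_zero, map_zero]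
    | tmul b z =>
      rw [grade_tmul, map_mul, hB, evC, Algebra.TensorProduct.tmul_mul_tmul, one_mul, mul_one]
    | add x y hx hy => rw [map_add, map_add, hx, hy]
  exact Function.LeftInverse.injective hev

/-- The intertwining series. -/
noncomputable def Theta : PowerSeries (Bor Q ⊗[ℂ] Osp Q) :=
  PowerSeries.mk fun m => theta Q m • ((bgen Q .a ^ m) ⊗ₜ[ℂ] (wO Q ^ m))

theorem coeff_Theta (m : ℕ) : PowerSeries.coeff m (Theta Q) =
    theta Q m • ((bgen Q .a ^ m) ⊗ₜ[ℂ] (wO Q ^ m)) := PowerSeries.coeff_mk _ _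

theorem Theta_cancel (f : PowerSeries (Bor Q ⊗[ℂ] Osp Q)) (h : f * Theta Q = 0) : f = 0 := by
  ext n
  induction n using Nat.strong_induction_on with
  | _ n ih =>
    have h1 : PowerSeries.coeff n (f * Theta Q) = 0 := by rw [h, map_zero]
    rw [PowerSeries.coeff_mul, Finset.sum_eq_single (n, 0)] at h1
    · rw [coeff_Theta] at h1
      simpa [theta, ← Algebra.TensorProduct.one_def] using h1
    · rintro ⟨i, j⟩ hij hne
      have hs : i + j = n := Finset.HasAntidiagonal.mem_antidiagonal.1 hij
      have hi : i < n := by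
        rcases Nat.eq_zero_or_pos j with hj | hj
        · exact absurd (by rw [hj] at hs ⊢; rw [← hs]; rfl) hne
        · omega
      rw [ih i hi, map_zero, zero_mul]
    · intro hn
      exact absurd (Finset.HasAntidiagonal.mem_antidiagonal.2 (add_zero n)) hn

/-- `b` is the value at `z` of the lifted coaction. -/
def IsCoval (z : Osp Q) (b : Bor Q ⊗[ℂ] subI Q) : Prop :=
  Theta Q * PowerSeries.C (phi Q z) =
    ((grade Q (inclI Q (Bor Q) b) : Polynomial (Bor Q ⊗[ℂ] Osp Q)) :
      PowerSeries (Bor Q ⊗[ℂ] Osp Q)) * Theta Q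

theorem IsCoval.unique {z : Osp Q} {b b' : Bor Q ⊗[ℂ] subI Q} (h : IsCoval Q z b)
    (h' : IsCoval Q z b') : b = b' := by
  have e := (h.symm.trans h')
  rw [← sub_eq_zero, ← sub_mul] at e
  have e2 := Theta_cancel Q _ e
  exact inclI_injective Q _ (grade_injective Q (Polynomial.coe_injective _ (sub_eq_zero.1 e2)))

theorem IsCoval.add {z z' : Osp Q} {b b' : Bor Q ⊗[ℂ] subI Q} (h : IsCoval Q z b)
    (h' : IsCoval Q z' b') : IsCoval Q (z + z') (b + b') := by
  unfold IsCoval at *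
  rw [map_add, map_add, map_add, map_add, mul_add, h, h', Polynomial.coe_add, add_mul]

theorem IsCoval.mul {z z' : Osp Q} {b b' : Bor Q ⊗[ℂ] subI Q} (h : IsCoval Q z b)
    (h' : IsCoval Q z' b') : IsCoval Q (z * z') (b * b') := by
  unfold IsCoval at *
  rw [map_mul, map_mul, map_mul, map_mul, ← mul_assoc, h, mul_assoc, h', Polynomial.coe_mul,
    mul_assoc]

theorem isCoval_algebraMap (c : ℂ) :
    IsCoval Q (algebraMap ℂ _ c) (algebraMap ℂ _ c) := by
  unfold IsCoval
  rw [AlgHom.commutes, AlgHom.commutes, AlgHom.commutes, Polynomial.algebraMap_apply,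
    Polynomial.coe_C]
  ext n
  rw [PowerSeries.coeff_mul_C, PowerSeries.coeff_C_mul]
  exact (Algebra.commutes c _).symm

theorem isCoval_casimir : IsCoval Q (casimir Q) (1 ⊗ₜ casI Q) := by
  unfold IsCoval
  rw [inclI_tmul, grade_tmul, map_one, one_mul, Polynomial.coe_C, phi_casimir]
  ext n
  rw [PowerSeries.coeff_mul_C, PowerSeries.coeff_C_mul, coeff_Theta, smul_mul_assoc,
    mul_smul_comm, Algebra.TensorProduct.tmul_mul_tmul, Algebra.TensorProduct.tmul_mul_tmul,
    casimir_w, mul_one, one_mul]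
  rfl

theorem isCoval_x : IsCoval Q (xO Q) (bgen Q .u ⊗ₜ xI Q) := by
  unfold IsCoval
  rw [inclI_tmul, grade_tmul, gradeB_gen]
  dsimp only
  rw [← Polynomial.C_mul, Polynomial.coe_C, phi_xO, Algebra.TensorProduct.tmul_mul_tmul, mul_one,
    one_mul]
  ext n
  rw [PowerSeries.coeff_mul_C, PowerSeries.coeff_C_mul, coeff_Theta, smul_mul_assoc,
    mul_smul_comm, Algebra.TensorProduct.tmul_mul_tmul, Algebra.TensorProduct.tmul_mul_tmul,
    w_pow_x, bor_u_pow, TensorProduct.tmul_smul, TensorProduct.smul_tmul']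
  rfl

theorem isCoval_k : IsCoval Q (kO Q)
    (1 ⊗ₜ kI Q + (-(Q.q - Q.q⁻¹)) • (bgen Q .a ⊗ₜ xI Q)) := by
  unfold IsCoval
  rw [map_add, map_smul, map_add, map_smul, inclI_tmul, inclI_tmul, grade_tmul, grade_tmul,
    gradeB_gen, map_one, one_mul, phi_kO]
  dsimp only
  rw [mul_assoc, ← Polynomial.C_mul, Algebra.TensorProduct.tmul_mul_tmul, mul_one, one_mul,
    ← mul_smul_comm, Polynomial.smul_C, Polynomial.coe_add, Polynomial.coe_mul, Polynomial.coe_C,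
    Polynomial.coe_C, Polynomial.coe_X, add_mul, mul_assoc]
  ext n
  rw [map_add, PowerSeries.coeff_mul_C, PowerSeries.coeff_C_mul, coeff_Theta]
  cases n with
  | zero =>
    rw [PowerSeries.coeff_zero_X_mul]
    simp [theta, ← Algebra.TensorProduct.one_def, kI]
  | succ m =>
    rw [PowerSeries.coeff_succ_X_mul, PowerSeries.coeff_C_mul, coeff_Theta]
    simp only [smul_mul_assoc, mul_smul_comm, Algebra.TensorProduct.tmul_mul_tmul, mul_one,
      one_mul, w_pow_k, ← pow_succ', TensorProduct.tmul_smul, smul_smul]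
    have e : (xI Q : Osp Q) * wO Q ^ m = (-Q.q) • (kO Q * wO Q ^ (m + 1)) := by
      change xO Q * _ = _
      rw [x_eq, smul_mul_assoc, mul_assoc, ← pow_succ']
    rw [e, TensorProduct.tmul_smul, smul_smul]
    change _ • ((bgen Q .a ^ (m + 1)) ⊗ₜ[ℂ] (kO Q * wO Q ^ (m + 1)))
      = _ • ((bgen Q .a ^ (m + 1)) ⊗ₜ[ℂ] (kO Q * wO Q ^ (m + 1))) + _
    rw [← add_smul]
    congr 1
    have ht := theta_succ Q m
    have := Q.q_ne_zero
    field_simp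
    linear_combination -ht

theorem isCoval_y : IsCoval Q (yO Q)
    (bgen Q .v ⊗ₜ yI Q + (bgen Q .a * bgen Q .v) ⊗ₜ
      ((Q.s⁻¹ * (Q.s - Q.s⁻¹)) • kI Q + (Q.s⁻¹ * (Q.q - Q.q⁻¹)) • casI Q) +
      (bgen Q .a * bgen Q .a * bgen Q .v) ⊗ₜ ((Q.q⁻¹ * (Q.q - Q.q⁻¹)) • xI Q)) := by
  unfold IsCoval
  simp only [map_add, inclI_tmul, grade_tmul, map_mul, gradeB_gen, phi_yO]
  set β : Osp Q := (((Q.s⁻¹ * (Q.s - Q.s⁻¹)) • kI Q + (Q.s⁻¹ * (Q.q - Q.q⁻¹)) • casI Q : subI Q) : Osp Q)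
    with hβ
  set γ : Osp Q := (((Q.q⁻¹ * (Q.q - Q.q⁻¹)) • xI Q : subI Q) : Osp Q) with hγ
  have hβ' : β = (Q.s⁻¹ * (Q.s - Q.s⁻¹)) • kO Q + (Q.s⁻¹ * (Q.q - Q.q⁻¹)) • casimir Q := rfl
  have hγ' : γ = (Q.q⁻¹ * (Q.q - Q.q⁻¹)) • xO Q := rfl
  have hy : ((yI Q : subI Q) : Osp Q) = yO Q := rfl
  have e1 : Polynomial.X * Polynomial.C (bgen Q .a ⊗ₜ[ℂ] (1 : Osp Q)) *
      Polynomial.C (bgen Q .v ⊗ₜ 1) * Polynomial.C (1 ⊗ₜ β) =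
      Polynomial.X * Polynomial.C ((bgen Q .a * bgen Q .v) ⊗ₜ β) := by
    rw [mul_assoc, mul_assoc, ← Polynomial.C_mul, ← Polynomial.C_mul,
      Algebra.TensorProduct.tmul_mul_tmul, Algebra.TensorProduct.tmul_mul_tmul]
    simp only [one_mul, mul_one]
  have e2 : Polynomial.X * Polynomial.C (bgen Q .a ⊗ₜ[ℂ] (1 : Osp Q)) *
      (Polynomial.X * Polynomial.C (bgen Q .a ⊗ₜ[ℂ] (1 : Osp Q))) *
      Polynomial.C (bgen Q .v ⊗ₜ 1) * Polynomial.C (1 ⊗ₜ γ) =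
      Polynomial.X * (Polynomial.X *
        Polynomial.C ((bgen Q .a * (bgen Q .a * bgen Q .v)) ⊗ₜ γ)) := by
    rw [mul_assoc Polynomial.X, ← mul_assoc (Polynomial.C _) Polynomial.X,
      ← Polynomial.X_mul_C]
    simp only [mul_assoc, ← Polynomial.C_mul, Algebra.TensorProduct.tmul_mul_tmul, one_mul,
      mul_one]
  rw [e1, e2, ← Polynomial.C_mul, Algebra.TensorProduct.tmul_mul_tmul, one_mul, mul_one, hy]
  simp only [Polynomial.coe_add, Polynomial.coe_mul, Polynomial.coe_C, Polynomial.coe_X, add_mul,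
    mul_assoc]
  have ea1 : bgen Q .a * bgen Q .v = (-Q.q) • (bgen Q .v * bgen Q .a) := bor_a_v Q
  have ea2 : bgen Q .a * (bgen Q .a * bgen Q .v) =
      (Q.q ^ 2) • (bgen Q .v * (bgen Q .a * bgen Q .a)) := by
    have := bor_pow_v Q 2
    simpa [pow_two, mul_assoc] using this
  rw [ea2, ea1]
  ext n
  simp only [map_add, PowerSeries.coeff_mul_C, PowerSeries.coeff_C_mul, coeff_Theta]
  have key : ∀ m : ℕ, (theta Q (m + 1) • ((bgen Q .a ^ (m + 1)) ⊗ₜ[ℂ] (wO Q ^ (m + 1)))) *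
      (bgen Q .v ⊗ₜ[ℂ] yO Q) =
      bgen Q .v ⊗ₜ[ℂ] yO Q * (theta Q (m + 1) • ((bgen Q .a ^ (m + 1)) ⊗ₜ[ℂ] (wO Q ^ (m + 1)))) +
      ((-Q.q) • (bgen Q .v * bgen Q .a)) ⊗ₜ[ℂ] β *
        (theta Q m • ((bgen Q .a ^ m) ⊗ₜ[ℂ] (wO Q ^ m))) +
      (theta Q m * ((-Q.q) ^ (m + 1) + Q.q)) •
        ((bgen Q .v * bgen Q .a ^ (m + 1)) ⊗ₜ[ℂ] (kO Q * wO Q ^ m)) := by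
    intro m
    simp only [smul_mul_assoc, mul_smul_comm, Algebra.TensorProduct.tmul_mul_tmul, bor_pow_v,
      ← TensorProduct.smul_tmul', smul_smul, mul_assoc, ← pow_succ']
    simp only [← TensorProduct.tmul_smul]
    rw [← TensorProduct.tmul_add, ← TensorProduct.tmul_add, leg_y, hβ']
    simp only [add_mul, smul_mul_assoc]
  cases n with
  | zero =>
    rw [PowerSeries.coeff_zero_X_mul, PowerSeries.coeff_zero_X_mul]
    simp [theta]
  | succ n =>
    rw [key, PowerSeries.coeff_succ_X_mul, PowerSeries.coeff_succ_X_mul, PowerSeries.coeff_C_mul,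
      coeff_Theta]
    congr 1
    cases n with
    | zero =>
      rw [PowerSeries.coeff_zero_X_mul]
      simp [theta]
    | succ m =>
      rw [PowerSeries.coeff_succ_X_mul, PowerSeries.coeff_C_mul, coeff_Theta, hγ']
      have e : xO Q * wO Q ^ m = (-Q.q) • (kO Q * wO Q ^ (m + 1)) := by
        rw [x_eq, smul_mul_assoc, mul_assoc, ← pow_succ']
      simp only [smul_mul_assoc, mul_smul_comm, Algebra.TensorProduct.tmul_mul_tmul,
        ← TensorProduct.smul_tmul', smul_smul, mul_assoc, ← pow_succ', e, TensorProduct.tmul_smul]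
      congr 1
      have ht := theta_succ Q m
      have := Q.q_ne_zero
      field_simp
      rw [pow_succ (-Q.q) (m + 1)]
      linear_combination (Q.q) * ht

theorem exists_coval (z : subI Q) : ∃ b, IsCoval Q z b := by
  obtain ⟨z, hz⟩ := z
  change ∃ b, IsCoval Q z b
  induction hz using Algebra.adjoin_induction with
  | mem z hz =>
    rcases hz with rfl | rfl | rfl | rfl
    · exact ⟨_, isCoval_x Q⟩
    · exact ⟨_, isCoval_y Q⟩
    · exact ⟨_, isCoval_k Q⟩
    · exact ⟨_, isCoval_casimir Q⟩
  | algebraMap c => exact ⟨_, isCoval_algebraMap Q c⟩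
  | add x y _ _ hx hy =>
    obtain ⟨b, hb⟩ := hx
    obtain ⟨b', hb'⟩ := hy
    exact ⟨_, hb.add Q hb'⟩
  | mul x y _ _ hx hy =>
    obtain ⟨b, hb⟩ := hx
    obtain ⟨b', hb'⟩ := hy
    exact ⟨_, hb.mul Q hb'⟩

noncomputable def covalFun (z : subI Q) : Bor Q ⊗[ℂ] subI Q := (exists_coval Q z).choose

theorem covalFun_eq {z : subI Q} {b : Bor Q ⊗[ℂ] subI Q} (h : IsCoval Q z b) :
    covalFun Q z = b := (exists_coval Q z).choose_spec.unique Q h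

theorem covalFun_spec (z : subI Q) : IsCoval Q z (covalFun Q z) := (exists_coval Q z).choose_spec

noncomputable def coval : subI Q →ₐ[ℂ] Bor Q ⊗[ℂ] subI Q where
  toFun := covalFun Q
  map_one' := covalFun_eq Q (by have := isCoval_algebraMap Q 1; rwa [map_one, map_one] at this)
  map_mul' x y := covalFun_eq Q ((covalFun_spec Q x).mul Q (covalFun_spec Q y))
  map_zero' := covalFun_eq Q (by have := isCoval_algebraMap Q 0; rwa [map_zero, map_zero] at this)
  map_add' x y := covalFun_eq Q ((covalFun_spec Q x).add Q (covalFun_spec Q y))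
  commutes' c := covalFun_eq Q (isCoval_algebraMap Q c)

theorem coval_eq {z : subI Q} {b : Bor Q ⊗[ℂ] subI Q} (h : IsCoval Q z b) :
    coval Q z = b := covalFun_eq Q h

noncomputable def borMap : Bor Q ⊗[ℂ] subI Q →ₐ[ℂ] Osp Q ⊗[ℂ] subI Q :=
  Algebra.TensorProduct.map (borToOsp Q) (AlgHom.id ℂ (subI Q))

/-- The coaction `τ : 𝓘 → osp_q(1|2) ⊗ 𝓘`.  It is determined by its values on the generators of
`𝓘`, which are computed in `tau_x`, `tau_y`, `tau_k` and `tau_casimir`. -/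
noncomputable def tau : subI Q →ₐ[ℂ] Osp Q ⊗[ℂ] subI Q :=
  (borMap Q).comp (coval Q)

theorem borMap_tmul (b : Bor Q) (z : subI Q) : borMap Q (b ⊗ₜ z) = borToOsp Q b ⊗ₜ z := by
  simp [borMap]

theorem tau_of_isCoval {z : subI Q} {b : Bor Q ⊗[ℂ] subI Q} (h : IsCoval Q z b) :
    tau Q z = borMap Q b := by
  rw [← coval_eq Q h]; rfl

theorem borToOsp_gen (g : BGen) : borToOsp Q (bgen Q g) = match g with
    | .a => yO Q
    | .u => kO Q
    | .v => Ki Q ^ 2 * P Q := borLift_gen Q _ _ g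

theorem tau_x : tau Q (xI Q) = (K Q ^ 2 * P Q) ⊗ₜ xI Q := by
  rw [tau_of_isCoval Q (z := xI Q) (isCoval_x Q), borMap_tmul, borToOsp_gen]
  rfl

theorem tau_y : tau Q (yI Q) = (Ki Q ^ 2 * P Q) ⊗ₜ yI Q
    + (Q.s⁻¹ * (Q.q - Q.q⁻¹)) • ((Ap Q ^ 2 * P Q) ⊗ₜ xI Q)
    + (Q.s⁻¹ * (Q.s - Q.s⁻¹)) • ((Ap Q * Ki Q * P Q) ⊗ₜ kI Q)
    + (Q.s⁻¹ * (Q.q - Q.q⁻¹)) • ((Ap Q * Ki Q * P Q) ⊗ₜ casI Q) := by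
  rw [tau_of_isCoval Q (z := yI Q) (isCoval_y Q)]
  have h := Q.s_ne_zero
  simp only [map_add, map_smul, borMap_tmul, map_mul, borToOsp_gen, yO, pow_two,
    mul_assoc, osp_nf, TensorProduct.tmul_add, TensorProduct.tmul_smul,
    mul_smul_comm, smul_mul_assoc, ← TensorProduct.smul_tmul', smul_smul]
  simp only [← Q.sq_s]
  match_scalars <;> field_simp

theorem tau_k : tau Q (kI Q) = 1 ⊗ₜ kI Q - (Q.q - Q.q⁻¹) • ((Ap Q * K Q) ⊗ₜ xI Q) := by
  rw [tau_of_isCoval Q (z := kI Q) (isCoval_k Q)]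
  simp only [map_add, map_smul, borMap_tmul, borToOsp_gen, map_one, yO]
  module

theorem tau_casimir : tau Q (casI Q) = 1 ⊗ₜ casI Q := by
  rw [tau_of_isCoval Q (z := casI Q) (isCoval_casimir Q), borMap_tmul, map_one]

end coaction

/-- The tensor powers of `osp_q(1|2)`, bundled with their algebra structure. -/
noncomputable def tensorPowAlg (Q : QParam) : ℕ → AlgCat.{0} ℂ
  | 0 => AlgCat.of ℂ ℂ
  | m + 1 => AlgCat.of ℂ (tensorPowAlg Q m ⊗[ℂ] Osp Q)

/-- The `m`-fold tensor product `osp_q(1|2)^{⊗ m}`, bracketed from the left, with the product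
`(a₁ ⊗ … ⊗ a_m)(b₁ ⊗ … ⊗ b_m) = a₁ b₁ ⊗ … ⊗ a_m b_m`. -/
def TensorPow (Q : QParam) (m : ℕ) : Type := tensorPowAlg Q m

noncomputable instance (Q : QParam) (m : ℕ) : Ring (TensorPow Q m) :=
  inferInstanceAs (Ring (tensorPowAlg Q m))
noncomputable instance (Q : QParam) (m : ℕ) : Algebra ℂ (TensorPow Q m) :=
  inferInstanceAs (Algebra ℂ (tensorPowAlg Q m))

/-- `osp_q(1|2)^{⊗ 0} = ℂ`. -/
noncomputable def tensorPowZero (Q : QParam) : ℂ ≃ₐ[ℂ] TensorPow Q 0 :=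
  (AlgEquiv.refl : ℂ ≃ₐ[ℂ] ℂ)

/-- `osp_q(1|2)^{⊗ (m+1)} = osp_q(1|2)^{⊗ m} ⊗ osp_q(1|2)`. -/
noncomputable def tensorPowSucc (Q : QParam) (m : ℕ) :
    TensorPow Q m ⊗[ℂ] Osp Q ≃ₐ[ℂ] TensorPow Q (m + 1) :=
  (AlgEquiv.refl : TensorPow Q m ⊗[ℂ] Osp Q ≃ₐ[ℂ] TensorPow Q m ⊗[ℂ] Osp Q)

section extension
variable (Q : QParam)

/-- `1 ⊗ … ⊗ 1 ⊗ f : osp^{⊗ m} ⊗ 𝓘 → osp^{⊗ (m+1)} ⊗ 𝓘` for `f : 𝓘 → osp ⊗ 𝓘`. -/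
noncomputable def lastLeg (m : ℕ) (f : subI Q →ₐ[ℂ] Osp Q ⊗[ℂ] subI Q) :
    TensorPow Q m ⊗[ℂ] subI Q →ₐ[ℂ] TensorPow Q (m + 1) ⊗[ℂ] subI Q :=
  (Algebra.TensorProduct.map (tensorPowSucc Q m : _ →ₐ[ℂ] _) (AlgHom.id ℂ (subI Q))).comp
    ((Algebra.TensorProduct.assoc ℂ ℂ ℂ (TensorPow Q m) (Osp Q) (subI Q)).symm.toAlgHom.comp
      (Algebra.TensorProduct.map (AlgHom.id ℂ (TensorPow Q m)) f))

/-- `1 ⊗ … ⊗ 1 ⊗ Δ : osp^{⊗ (m+1)} → osp^{⊗ (m+2)}`. -/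
noncomputable def comulLast (m : ℕ) : TensorPow Q (m + 1) →ₐ[ℂ] TensorPow Q (m + 2) :=
  (tensorPowSucc Q (m + 1)).toAlgHom.comp
    ((Algebra.TensorProduct.map (tensorPowSucc Q m : _ →ₐ[ℂ] _) (AlgHom.id ℂ (Osp Q))).comp
      ((Algebra.TensorProduct.assoc ℂ ℂ ℂ (TensorPow Q m) (Osp Q) (Osp Q)).symm.toAlgHom.comp
        ((Algebra.TensorProduct.map (AlgHom.id ℂ (TensorPow Q m)) (comul Q)).comp
          (tensorPowSucc Q m).symm.toAlgHom)))

/-- `1 ⊗ … ⊗ 1 ⊗ Δ ⊗ 1 : osp^{⊗ (m+1)} ⊗ 𝓘 → osp^{⊗ (m+2)} ⊗ 𝓘`. -/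
noncomputable def comulPenultimate (m : ℕ) :
    TensorPow Q (m + 1) ⊗[ℂ] subI Q →ₐ[ℂ] TensorPow Q (m + 2) ⊗[ℂ] subI Q :=
  Algebra.TensorProduct.map (comulLast Q m) (AlgHom.id ℂ (subI Q))

/-- The number of tensor legs in front of the last one after position `p + 1` has been treated:
`p` if `p + 1 ∈ A`, and `p + 1` if `p + 1 ∉ A`, because then there is one leg more, which is
reserved for the next element of `A`. -/
def legs : Bool → ℕ → ℕ
  | true, p => p
  | false, p => p + 1

/-- The extension morphism `τ_{k-1,k}^A` for `k = p + 2`.  The booleans tell whether `k - 1 ∈ A`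
and whether `k ∈ A`. -/
noncomputable def extend : (b b' : Bool) → (p : ℕ) →
    (TensorPow Q (legs b p) ⊗[ℂ] subI Q →ₐ[ℂ] TensorPow Q (legs b' (p + 1)) ⊗[ℂ] subI Q)
  | true, true, p => lastLeg Q p (comulI Q)
  | true, false, p => (lastLeg Q (p + 1) (tau Q)).comp (lastLeg Q p (comulI Q))
  | false, false, p => comulPenultimate Q p
  | false, true, p => AlgHom.id ℂ (TensorPow Q (p + 1) ⊗[ℂ] subI Q)

/-- The element `1 ⊗ … ⊗ 1 ⊗ (τ_{k-1,k}^A ⋯ τ_{a,a+1}^A)(Γ^q)` for `k = p + 1`, with the `a - 1`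
units in front already inserted; it is `1 ⊗ … ⊗ 1 ⊗ Γ^q` for `k = a`.  Here `a = min A`. -/
noncomputable def chain (A : Finset ℕ) (a : ℕ) :
    (p : ℕ) → TensorPow Q (legs (decide (p + 1 ∈ A)) p) ⊗[ℂ] subI Q
  | 0 => 1 ⊗ₜ casI Q
  | p + 1 =>
    if p + 2 ≤ a then 1 ⊗ₜ casI Q
    else extend Q (decide (p + 1 ∈ A)) (decide (p + 2 ∈ A)) p (chain A a p)

/-- Regard an element of `osp^{⊗ p} ⊗ 𝓘` as an element of `osp^{⊗ (p+1)}`.  The case `false`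
does not occur at the position `max A`. -/
noncomputable def forgetI : (b : Bool) → (p : ℕ) →
    TensorPow Q (legs b p) ⊗[ℂ] subI Q → TensorPow Q (p + 1)
  | true, p, z => tensorPowSucc Q p (inclI Q (TensorPow Q p) z)
  | false, _, _ => 0

/-- The chain up to position `max A = m`, followed by `n - m` units. -/
noncomputable def padded (A : Finset ℕ) (a m : ℕ) : (n : ℕ) → TensorPow Q n
  | 0 => 0
  | n + 1 =>
    if n + 1 = m then forgetI Q (decide (n + 1 ∈ A)) n (chain Q A a n)
    else tensorPowSucc Q n (padded A a m n ⊗ₜ 1)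

/-- The intermediate Casimir element `Γ_A^q ∈ osp_q(1|2)^{⊗ n}` of a set `A ⊆ {1, …, n}`;
`Γ_∅^q = -[1/2]_q`. -/
noncomputable def Gam (n : ℕ) (A : Finset ℕ) : TensorPow Q n :=
  if h : A.Nonempty then padded Q A (A.min' h) (A.max' h) n
  else algebraMap ℂ _ (-((Q.s - Q.s⁻¹) / (Q.q - Q.q⁻¹)))

end extension

/-- The `q`-anticommutator `{X, Y}_q = q^{1/2} X Y + q^{-1/2} Y X`. -/
noncomputable def qAnti (Q : QParam) {R : Type} [Ring R] [Algebra ℂ R] (X Y : R) : R :=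
  Q.s • (X * Y) + Q.s⁻¹ • (Y * X)

/-- `A` matches `B`: `max (A \ (A ∩ B)) < min (A ∩ B)` and `max (A ∩ B) < min (B \ (A ∩ B))`. -/
def Matches (A B : Finset ℕ) : Prop :=
  ∃ (h₁ : (A \ (A ∩ B)).Nonempty) (h₂ : (A ∩ B).Nonempty) (h₃ : (B \ (A ∩ B)).Nonempty),
    (A \ (A ∩ B)).max' h₁ < (A ∩ B).min' h₂ ∧ (A ∩ B).max' h₂ < (B \ (A ∩ B)).min' h₃

/-- `X` and `Y` and `Z` satisfy the cyclic relations of a rank 1 `q`-Bannai-Ito algebra with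
structure elements `α`, `β`, `γ`, which are central in the algebra generated by `X`, `Y`, `Z`. -/
structure GenerateQBannaiIto (Q : QParam) {R : Type} [Ring R] [Algebra ℂ R]
    (X Y Z α β γ : R) : Prop where
  rel_XY : qAnti Q X Y = Z + α
  rel_YZ : qAnti Q Y Z = X + β
  rel_ZX : qAnti Q Z X = Y + γ
  central : ∀ w ∈ Algebra.adjoin ℂ {X, Y, Z}, Commute α w ∧ Commute β w ∧ Commute γ w

end QBI

namespace QBI

/-! ### Normal forms in which the Casimir element is an independent central symbol. -/

section casimirNormalForm
variable (Q : QParam)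

/-! Since `A` is an interval and matches `B`, the set `A ∪ B` splits into three blocks in increasing
order: the intervals `A \ B = (a, m]` and `A ∩ B = (m, j]`, and the set `T = B \ A`, which lies
beyond `j` and may have holes. In terms of these blocks, `A`, `B`, `C` are the pairs 12, 23, 13, and
every other set in the relations is a single block or the union of all three. The theorem is
therefore the image of the case `A = {1,2}`, `B = {2,3}` under one algebra morphism from `osp ⊗ osp
⊗ 𝓘` to `osp^{⊗ n}`. It spreads the first two legs over their intervals by iterated coproducts,
sends the third through the chain of `Δ` and `τ` prescribed by `T`, and inserts units elsewhere.
`exists_threeBlocks` constructs it, and `GenerateQBannaiIto.map` transports the relations;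
injectivity is not needed.

A single morphism serves all the sets at once because `Δ` and `τ` are both left coactions of `osp`
on `𝓘` (`isCoaction_comulI`, `isCoaction_tau`). Iterating a coaction `f` over a block is the same as
applying `f` once and then iterated coproducts on the new leg. The spreading is thus the same
whether the block belongs to the set or not; only the first application of `Δ` or `τ` remembers
membership. As `τ(Γ) = 1 ⊗ Γ`, positions before the minimum of the set can be treated as holes too.

In three legs, the first two relations follow by expanding `Δ(Γ)` along its second leg: each of the
elements `A_- K`, `A_+ K`, `K² P` gives a relation between `v ⊗ 1`, `Δ(Γ)` and `τ(v)` in two legs,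
and `Γ` itself is central. The third relation is instead expanded along the last leg, with the first
two grouped together. The total Casimir commutes with `Γ_{12}` and `Γ_{23}` by coassociativity,
hence with `Γ_{13}` by the first relation, and the single-leg Casimirs are central, so the structure
terms are central in the generated algebra. -/

theorem Ap_Am_eq : Ap Q * Am Q =
    (Q.q - Q.q⁻¹)⁻¹ • (Q.s⁻¹ • (K Q * K Q) - Q.s • (Ki Q * Ki Q)) - casimir Q * P Q := by
  rw [casimir, mul_assoc, P_P, mul_one, pow_two, pow_two]
  abel

/-- Together with the anticommutation relation, the Casimir removes this product as well. With no
mixed product of `A_+` and `A_-` left, the tensor identities below reduce to comparing coefficients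
of monomials. -/
theorem Am_Ap_eq : Am Q * Ap Q =
    (Q.q - Q.q⁻¹)⁻¹ • (Q.s • (K Q * K Q) - Q.s⁻¹ • (Ki Q * Ki Q)) + casimir Q * P Q := by
  have h := Q.s_ne_zero
  have h1 := Q.s_sq_sub_one_ne_zero
  have h2 := Q.s_sq_add_one_ne_zero
  rw [Am_Ap, Ap_Am_eq, Q.q_sub_inv, Q.s_sub_inv]
  match_scalars <;> field_simp <;> ring

/-- Rewriting rules that bring a monomial in the order `Γ^q`, `A_±`, `K^{±1}`, `P`, eliminating the
products of `A_+` with `A_-`. -/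
theorem casimir_nf :
    (Ap Q * casimir Q = casimir Q * Ap Q ∧ Am Q * casimir Q = casimir Q * Am Q ∧
      K Q * casimir Q = casimir Q * K Q ∧ Ki Q * casimir Q = casimir Q * Ki Q ∧
      P Q * casimir Q = casimir Q * P Q ∧
      K Q * Ki Q = 1 ∧ Ki Q * K Q = 1 ∧ K Q * Ap Q = Q.s • (Ap Q * K Q) ∧
      K Q * Am Q = Q.s⁻¹ • (Am Q * K Q) ∧ Ki Q * Ap Q = Q.s⁻¹ • (Ap Q * Ki Q) ∧
      Ki Q * Am Q = Q.s • (Am Q * Ki Q) ∧ P Q * Ap Q = - (Ap Q * P Q) ∧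
      P Q * Am Q = - (Am Q * P Q) ∧ P Q * K Q = K Q * P Q ∧ P Q * Ki Q = Ki Q * P Q ∧
      P Q * P Q = 1 ∧
      Ap Q * Am Q =
        (Q.q - Q.q⁻¹)⁻¹ • (Q.s⁻¹ • (K Q * K Q) - Q.s • (Ki Q * Ki Q)) - casimir Q * P Q ∧
      Am Q * Ap Q =
        (Q.q - Q.q⁻¹)⁻¹ • (Q.s • (K Q * K Q) - Q.s⁻¹ • (Ki Q * Ki Q)) + casimir Q * P Q) ∧
    ∀ z : Osp Q, Ap Q * (casimir Q * z) = casimir Q * (Ap Q * z) ∧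
      Am Q * (casimir Q * z) = casimir Q * (Am Q * z) ∧
      K Q * (casimir Q * z) = casimir Q * (K Q * z) ∧
      Ki Q * (casimir Q * z) = casimir Q * (Ki Q * z) ∧
      P Q * (casimir Q * z) = casimir Q * (P Q * z) ∧
      K Q * (Ki Q * z) = z ∧ Ki Q * (K Q * z) = z ∧
      K Q * (Ap Q * z) = Q.s • (Ap Q * (K Q * z)) ∧
      K Q * (Am Q * z) = Q.s⁻¹ • (Am Q * (K Q * z)) ∧
      Ki Q * (Ap Q * z) = Q.s⁻¹ • (Ap Q * (Ki Q * z)) ∧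
      Ki Q * (Am Q * z) = Q.s • (Am Q * (Ki Q * z)) ∧
      P Q * (Ap Q * z) = - (Ap Q * (P Q * z)) ∧ P Q * (Am Q * z) = - (Am Q * (P Q * z)) ∧
      P Q * (K Q * z) = K Q * (P Q * z) ∧ P Q * (Ki Q * z) = Ki Q * (P Q * z) ∧
      P Q * (P Q * z) = z ∧
      Ap Q * (Am Q * z) = (Q.q - Q.q⁻¹)⁻¹ • (Q.s⁻¹ • (K Q * (K Q * z))
        - Q.s • (Ki Q * (Ki Q * z))) - casimir Q * (P Q * z) ∧
      Am Q * (Ap Q * z) = (Q.q - Q.q⁻¹)⁻¹ • (Q.s • (K Q * (K Q * z))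
        - Q.s⁻¹ • (Ki Q * (Ki Q * z))) + casimir Q * (P Q * z) := by
  have hn := osp_nf Q
  refine ⟨⟨(casimir_Ap Q).symm, (casimir_Am Q).symm, (casimir_K Q).symm, (casimir_Ki Q).symm,
    (casimir_P Q).symm, K_Ki Q, Ki_K Q, K_Ap Q, K_Am Q, Ki_Ap Q, Ki_Am Q, P_Ap Q, P_Am Q, P_K Q,
    P_Ki Q, P_P Q, Ap_Am_eq Q, Am_Ap_eq Q⟩, fun z => ⟨?_, ?_, ?_, ?_, ?_, ?_⟩⟩
  · rw [assoc_of (casimir_Ap Q).symm, mul_assoc]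
  · rw [assoc_of (casimir_Am Q).symm, mul_assoc]
  · rw [assoc_of (casimir_K Q).symm, mul_assoc]
  · rw [assoc_of (casimir_Ki Q).symm, mul_assoc]
  · rw [assoc_of (casimir_P Q).symm, mul_assoc]
  · obtain ⟨a1, a2, a3, a4, a5, a6, a7, a8, a9, a10, a11, -⟩ := hn.2 z
    refine ⟨a1, a2, a3, a4, a5, a6, a7, a8, a9, a10, a11, ?_, ?_⟩
    · rw [assoc_of (Ap_Am_eq Q)]
      simp only [sub_mul, smul_mul_assoc, mul_assoc]
    · rw [assoc_of (Am_Ap_eq Q)]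
      simp only [sub_mul, add_mul, smul_mul_assoc, mul_assoc]

-- The coefficient of the third term is `[1/2]_q` written as `(s + s⁻¹)⁻¹`. In this form it visibly
-- cancels the factor `s + s⁻¹` of the structure terms, a cancellation on which all three relations
-- depend.
open TensorProduct in
theorem comul_casimir_eq : comul Q (casimir Q) =
    -(Q.s • ((Am Q * Ki Q * P Q) ⊗ₜ yO Q)) + Q.s⁻¹ • ((Ap Q * Ki Q * P Q) ⊗ₜ xO Q)
      + (Q.s + Q.s⁻¹)⁻¹ • ((Ki Q ^ 2 * P Q) ⊗ₜ kO Q) + casimir Q ⊗ₜ kO Q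
      + (Ki Q ^ 2 * P Q) ⊗ₜ casimir Q := by
  have h := Q.s_ne_zero
  have h1 := Q.s_sq_sub_one_ne_zero
  have h2 := Q.s_sq_add_one_ne_zero
  have e : (Q.s - Q.s⁻¹) / (Q.q - Q.q⁻¹) = (Q.s + Q.s⁻¹)⁻¹ := by
    rw [Q.q_sub_inv, Q.s_sub_inv]; field_simp
  rw [comul_casimir, e]
  simp only [map_add, map_neg, map_smul, inclI_tmul]
  rfl

end casimirNormalForm

/-! ### Two-leg `q`-anticommutators with `Δ(Γ)`, one for each term of the expansion of `Γ_{12}` or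
`Γ_{13}`. -/

section rows
variable (Q : QParam)

open TensorProduct

theorem coe_xI : (xI Q : Osp Q) = xO Q := rfl
theorem coe_yI : (yI Q : Osp Q) = yO Q := rfl
theorem coe_kI : (kI Q : Osp Q) = kO Q := rfl
theorem coe_casI : (casI Q : Osp Q) = casimir Q := rfl

theorem comulI_x : comulI Q (xI Q) = xO Q ⊗ₜ kI Q + 1 ⊗ₜ xI Q :=
  inclI_injective Q _ ((inclI_comulI Q _).trans (comul_xO Q))

theorem comulI_y : comulI Q (yI Q) = yO Q ⊗ₜ kI Q + 1 ⊗ₜ yI Q :=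
  inclI_injective Q _ ((inclI_comulI Q _).trans (comul_yO Q))

theorem comulI_k : comulI Q (kI Q) = kO Q ⊗ₜ kI Q :=
  inclI_injective Q _ ((inclI_comulI Q _).trans (comul_kO Q))

theorem comulI_cas : comulI Q (casI Q) =
    -(Q.s • ((Am Q * Ki Q * P Q) ⊗ₜ yI Q)) + Q.s⁻¹ • ((Ap Q * Ki Q * P Q) ⊗ₜ xI Q)
      + (Q.s + Q.s⁻¹)⁻¹ • ((Ki Q ^ 2 * P Q) ⊗ₜ kI Q) + casimir Q ⊗ₜ kI Q
      + (Ki Q ^ 2 * P Q) ⊗ₜ casI Q := by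
  refine inclI_injective Q _ ((inclI_comulI Q _).trans ((comul_casimir_eq Q).trans ?_))
  simp only [map_add, map_neg, map_smul, inclI_tmul]
  rfl

/-- This is the origin of `τ`: up to the term with `Γ_1`, its value at `v` is what `q`-anticommuting
`v ⊗ 1` with `Δ(Γ)` produces. The analogues for `A_+ K` and `K² P` account for the other values. -/
theorem qAnti_tmul_one_x : qAnti Q (xO Q ⊗ₜ 1) (comulI Q (casI Q)) = tau Q (xI Q) +
    (Q.s + Q.s⁻¹) • (casimir Q ⊗ₜ 1 * comulI Q (xI Q)) := by
  -- The defining relations are available in `osp` but not directly in `𝓘`, so the identity is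
  -- checked in `osp ⊗ osp`.
  apply inclI_injective
  have h := Q.s_ne_zero
  have h1 := Q.s_sq_sub_one_ne_zero
  have h2 := Q.s_sq_add_one_ne_zero
  simp only [OneMemClass.coe_one, map_add, map_sub, map_smul, map_mul, inclI_comulI, inclI_tmul, tau_x, tau_y, tau_k,
    coe_xI, coe_yI, coe_kI, coe_casI, comul_gen, comulGen, comul_casimir_eq, qAnti, xO, yO,
    kO, pow_two, mul_add, add_mul, Algebra.TensorProduct.tmul_mul_tmul,
    mul_assoc, casimir_nf, mul_neg, neg_mul, mul_smul_comm, smul_mul_assoc, mul_one, one_mul,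
    ← smul_tmul', tmul_smul, tmul_neg, neg_tmul, smul_smul, smul_add, smul_sub, smul_neg, neg_neg,
    mul_sub, sub_mul, tmul_sub, sub_tmul, tmul_add, add_tmul, Q.q_sub_inv, Q.s_sub_inv]
  match_scalars <;> field_simp <;> ring

/-- A second `q`-anticommutator with `Δ(Γ)`, in the opposite order, leads back from `τ(v)` to `v ⊗
1`. The Casimir in the correction is now that of the second leg. -/
theorem qAnti_tau_x : qAnti Q (comulI Q (casI Q)) (tau Q (xI Q)) = xO Q ⊗ₜ 1 +
    (Q.s + Q.s⁻¹) • (1 ⊗ₜ casI Q * comulI Q (xI Q)) := by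
  apply inclI_injective
  have h := Q.s_ne_zero
  have h1 := Q.s_sq_sub_one_ne_zero
  have h2 := Q.s_sq_add_one_ne_zero
  simp only [OneMemClass.coe_one, map_add, map_sub, map_smul, map_mul, inclI_comulI, inclI_tmul, tau_x, tau_y, tau_k,
    coe_xI, coe_yI, coe_kI, coe_casI, comul_gen, comulGen, comul_casimir_eq, qAnti, xO, yO,
    kO, pow_two, mul_add, add_mul, Algebra.TensorProduct.tmul_mul_tmul,
    mul_assoc, casimir_nf, mul_neg, neg_mul, mul_smul_comm, smul_mul_assoc, mul_one, one_mul,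
    ← smul_tmul', tmul_smul, tmul_neg, neg_tmul, smul_smul, smul_add, smul_sub, smul_neg, neg_neg,
    mul_sub, sub_mul, tmul_sub, sub_tmul, tmul_add, add_tmul, Q.q_sub_inv, Q.s_sub_inv]
  match_scalars <;> field_simp <;> ring

theorem qAnti_tmul_one_y : qAnti Q (yO Q ⊗ₜ 1) (comulI Q (casI Q)) = tau Q (yI Q) +
    (Q.s + Q.s⁻¹) • (casimir Q ⊗ₜ 1 * comulI Q (yI Q)) := by
  apply inclI_injective
  have h := Q.s_ne_zero
  have h1 := Q.s_sq_sub_one_ne_zero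
  have h2 := Q.s_sq_add_one_ne_zero
  simp only [OneMemClass.coe_one, map_add, map_sub, map_smul, map_mul, inclI_comulI, inclI_tmul, tau_x, tau_y, tau_k,
    coe_xI, coe_yI, coe_kI, coe_casI, comul_gen, comulGen, comul_casimir_eq, qAnti, xO, yO,
    kO, pow_two, mul_add, add_mul, Algebra.TensorProduct.tmul_mul_tmul,
    mul_assoc, casimir_nf, mul_neg, neg_mul, mul_smul_comm, smul_mul_assoc, mul_one, one_mul,
    ← smul_tmul', tmul_smul, tmul_neg, neg_tmul, smul_smul, smul_add, smul_sub, smul_neg, neg_neg,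
    mul_sub, sub_mul, tmul_sub, sub_tmul, tmul_add, add_tmul, Q.q_sub_inv, Q.s_sub_inv]
  match_scalars <;> field_simp <;> ring

theorem qAnti_tau_y : qAnti Q (comulI Q (casI Q)) (tau Q (yI Q)) = yO Q ⊗ₜ 1 +
    (Q.s + Q.s⁻¹) • (1 ⊗ₜ casI Q * comulI Q (yI Q)) := by
  apply inclI_injective
  have h := Q.s_ne_zero
  have h1 := Q.s_sq_sub_one_ne_zero
  have h2 := Q.s_sq_add_one_ne_zero
  simp only [OneMemClass.coe_one, map_add, map_sub, map_smul, map_mul, inclI_comulI, inclI_tmul, tau_x, tau_y, tau_k,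
    coe_xI, coe_yI, coe_kI, coe_casI, comul_gen, comulGen, comul_casimir_eq, qAnti, xO, yO,
    kO, pow_two, mul_add, add_mul, Algebra.TensorProduct.tmul_mul_tmul,
    mul_assoc, casimir_nf, mul_neg, neg_mul, mul_smul_comm, smul_mul_assoc, mul_one, one_mul,
    ← smul_tmul', tmul_smul, tmul_neg, neg_tmul, smul_smul, smul_add, smul_sub, smul_neg, neg_neg,
    mul_sub, sub_mul, tmul_sub, sub_tmul, tmul_add, add_tmul, Q.q_sub_inv, Q.s_sub_inv]
  match_scalars <;> field_simp <;> ring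

/-- Unlike the rows for `A_± K`, this one has an extra `1 ⊗ Γ`. It supplies both the term of
`Γ_{13}` ending in `τ(Γ)`, which the central row cannot give, and the product `Γ_1 Γ_3`. -/
theorem qAnti_tmul_one_k : qAnti Q (kO Q ⊗ₜ 1) (comulI Q (casI Q)) = tau Q (kI Q) +
    (Q.s + Q.s⁻¹) • (casimir Q ⊗ₜ 1 * comulI Q (kI Q) + 1 ⊗ₜ casI Q) := by
  apply inclI_injective
  have h := Q.s_ne_zero
  have h1 := Q.s_sq_sub_one_ne_zero
  have h2 := Q.s_sq_add_one_ne_zero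
  simp only [OneMemClass.coe_one, map_add, map_sub, map_smul, map_mul, inclI_comulI, inclI_tmul, tau_x, tau_y, tau_k,
    coe_xI, coe_yI, coe_kI, coe_casI, comul_gen, comulGen, comul_casimir_eq, qAnti, xO, yO,
    kO, pow_two, mul_add, add_mul, Algebra.TensorProduct.tmul_mul_tmul,
    mul_assoc, casimir_nf, mul_neg, neg_mul, mul_smul_comm, smul_mul_assoc, mul_one, one_mul,
    ← smul_tmul', tmul_smul, tmul_neg, neg_tmul, smul_smul, smul_add, smul_sub, smul_neg, neg_neg,
    mul_sub, sub_mul, tmul_sub, sub_tmul, tmul_add, add_tmul, Q.q_sub_inv, Q.s_sub_inv]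
  match_scalars <;> field_simp <;> ring

theorem qAnti_tau_k : qAnti Q (comulI Q (casI Q)) (tau Q (kI Q)) = kO Q ⊗ₜ 1 +
    (Q.s + Q.s⁻¹) • (1 ⊗ₜ casI Q * comulI Q (kI Q) + casimir Q ⊗ₜ 1) := by
  apply inclI_injective
  have h := Q.s_ne_zero
  have h1 := Q.s_sq_sub_one_ne_zero
  have h2 := Q.s_sq_add_one_ne_zero
  simp only [OneMemClass.coe_one, map_add, map_sub, map_smul, map_mul, inclI_comulI, inclI_tmul, tau_x, tau_y, tau_k,
    coe_xI, coe_yI, coe_kI, coe_casI, comul_gen, comulGen, comul_casimir_eq, qAnti, xO, yO,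
    kO, pow_two, mul_add, add_mul, Algebra.TensorProduct.tmul_mul_tmul,
    mul_assoc, casimir_nf, mul_neg, neg_mul, mul_smul_comm, smul_mul_assoc, mul_one, one_mul,
    ← smul_tmul', tmul_smul, tmul_neg, neg_tmul, smul_smul, smul_add, smul_sub, smul_neg, neg_neg,
    mul_sub, sub_mul, tmul_sub, sub_tmul, tmul_add, add_tmul, Q.q_sub_inv, Q.s_sub_inv]
  match_scalars <;> field_simp <;> ring

/-- This and the next two rows serve the third relation. Up to scalars and, for `K² P`, a central
summand, their left entries are the coefficients in `osp ⊗ osp` of the generators of `𝓘` in the last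
leg of `Γ_{13}`. -/
theorem qAnti_leg_y : qAnti Q ((Am Q * Ki Q * P Q) ⊗ₜ (Ki Q ^ 2 * P Q)) (comul Q (casimir Q)) =
    1 ⊗ₜ (Am Q * Ki Q * P Q) +
    (Q.s + Q.s⁻¹) • (casimir Q ⊗ₜ 1 * comul Q (Am Q * Ki Q * P Q)) := by
  have h := Q.s_ne_zero
  have h1 := Q.s_sq_sub_one_ne_zero
  have h2 := Q.s_sq_add_one_ne_zero
  simp only [map_add, map_sub, map_smul, map_mul, inclI_comulI, inclI_tmul, tau_x, tau_y, tau_k,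
    coe_xI, coe_yI, coe_kI, coe_casI, comul_gen, comulGen, comul_casimir_eq, qAnti, xO, yO,
    kO, pow_two, mul_add, add_mul, Algebra.TensorProduct.tmul_mul_tmul,
    mul_assoc, casimir_nf, mul_neg, neg_mul, mul_smul_comm, smul_mul_assoc, mul_one, one_mul,
    ← smul_tmul', tmul_smul, tmul_neg, neg_tmul, smul_smul, smul_add, smul_sub, smul_neg, neg_neg,
    mul_sub, sub_mul, tmul_sub, sub_tmul, tmul_add, add_tmul, Q.q_sub_inv, Q.s_sub_inv]
  match_scalars <;> field_simp <;> ring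

theorem qAnti_leg_x : qAnti Q
    (-((Q.q - Q.q⁻¹) • ((Am Q * Ki Q * P Q) ⊗ₜ (Ap Q ^ 2 * P Q))) +
      Q.s⁻¹ • ((Ap Q * Ki Q * P Q) ⊗ₜ kO Q) -
      (Q.s - Q.s⁻¹) • ((Ki Q ^ 2 * P Q) ⊗ₜ yO Q) - (Q.q - Q.q⁻¹) • (casimir Q ⊗ₜ yO Q))
    (comul Q (casimir Q)) =
    Q.s⁻¹ • (1 ⊗ₜ (Ap Q * Ki Q * P Q)) +
    (Q.s + Q.s⁻¹) • (casimir Q ⊗ₜ 1 * Q.s⁻¹ • comul Q (Ap Q * Ki Q * P Q)) := by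
  have h := Q.s_ne_zero
  have h1 := Q.s_sq_sub_one_ne_zero
  have h2 := Q.s_sq_add_one_ne_zero
  simp only [map_add, map_sub, map_smul, map_mul, inclI_comulI, inclI_tmul, tau_x, tau_y, tau_k,
    coe_xI, coe_yI, coe_kI, coe_casI, comul_gen, comulGen, comul_casimir_eq, qAnti, xO, yO,
    kO, pow_two, mul_add, add_mul, Algebra.TensorProduct.tmul_mul_tmul,
    mul_assoc, casimir_nf, mul_neg, neg_mul, mul_smul_comm, smul_mul_assoc, mul_one, one_mul,
    ← smul_tmul', tmul_smul, tmul_neg, neg_tmul, smul_smul, smul_add, smul_sub, smul_neg, neg_neg,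
    mul_sub, sub_mul, tmul_sub, sub_tmul, tmul_add, add_tmul, Q.q_sub_inv, Q.s_sub_inv]
  match_scalars <;> field_simp <;> ring

theorem qAnti_leg_cas : qAnti Q
    (-((Q.q - Q.q⁻¹) • ((Am Q * Ki Q * P Q) ⊗ₜ (Ap Q * Ki Q * P Q))) + (Ki Q ^ 2 * P Q) ⊗ₜ 1)
    (comul Q (casimir Q)) =
    1 ⊗ₜ (Ki Q ^ 2 * P Q) +
    (Q.s + Q.s⁻¹) • (casimir Q ⊗ₜ 1 * comul Q (Ki Q ^ 2 * P Q) + 1 ⊗ₜ casimir Q) := by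
  have h := Q.s_ne_zero
  have h1 := Q.s_sq_sub_one_ne_zero
  have h2 := Q.s_sq_add_one_ne_zero
  simp only [map_add, map_sub, map_smul, map_mul, inclI_comulI, inclI_tmul, tau_x, tau_y, tau_k,
    coe_xI, coe_yI, coe_kI, coe_casI, comul_gen, comulGen, comul_casimir_eq, qAnti, xO, yO,
    kO, pow_two, mul_add, add_mul, Algebra.TensorProduct.tmul_mul_tmul,
    mul_assoc, casimir_nf, mul_neg, neg_mul, mul_smul_comm, smul_mul_assoc, mul_one, one_mul,
    ← smul_tmul', tmul_smul, tmul_neg, neg_tmul, smul_smul, smul_add, smul_sub, smul_neg, neg_neg,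
    mul_sub, sub_mul, tmul_sub, sub_tmul, tmul_add, add_tmul, Q.q_sub_inv, Q.s_sub_inv]
  match_scalars <;> field_simp <;> ring

end rows
end QBI

namespace QBI

/-! ### Formal rules for the `q`-anticommutator. -/

section qAnti
variable (Q : QParam) {R S : Type} [Ring R] [Algebra ℂ R] [Ring S] [Algebra ℂ S]

theorem qAnti_add_left (X X' Y : R) : qAnti Q (X + X') Y = qAnti Q X Y + qAnti Q X' Y := by
  simp only [qAnti, add_mul, mul_add, smul_add]; abel

theorem qAnti_add_right (X Y Y' : R) : qAnti Q X (Y + Y') = qAnti Q X Y + qAnti Q X Y' := by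
  simp only [qAnti, add_mul, mul_add, smul_add]; abel

theorem qAnti_neg_left (X Y : R) : qAnti Q (-X) Y = -qAnti Q X Y := by
  simp only [qAnti, neg_mul, mul_neg, smul_neg]; abel

theorem qAnti_neg_right (X Y : R) : qAnti Q X (-Y) = -qAnti Q X Y := by
  simp only [qAnti, neg_mul, mul_neg, smul_neg]; abel

theorem qAnti_smul_left (c : ℂ) (X Y : R) : qAnti Q (c • X) Y = c • qAnti Q X Y := by
  simp only [qAnti, smul_mul_assoc, mul_smul_comm, smul_add]; module

theorem qAnti_smul_right (c : ℂ) (X Y : R) : qAnti Q X (c • Y) = c • qAnti Q X Y := by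
  simp only [qAnti, smul_mul_assoc, mul_smul_comm, smul_add]; module

theorem qAnti_of_commute {X Y : R} (h : Commute X Y) :
    qAnti Q X Y = (Q.s + Q.s⁻¹) • (X * Y) := by
  rw [qAnti, ← h.eq, add_smul]

theorem map_qAnti (F : R →ₐ[ℂ] S) (X Y : R) : F (qAnti Q X Y) = qAnti Q (F X) (F Y) := by
  simp only [qAnti, map_add, map_smul, map_mul]

theorem qAnti_tmul_one_tmul (r : R) (X Y : S) :
    qAnti Q (r ⊗ₜ[ℂ] X) (1 ⊗ₜ[ℂ] Y) = r ⊗ₜ[ℂ] qAnti Q X Y := by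
  simp only [qAnti, Algebra.TensorProduct.tmul_mul_tmul, mul_one, one_mul,
    TensorProduct.tmul_add, TensorProduct.tmul_smul]

theorem qAnti_one_tmul_tmul (r : R) (X Y : S) :
    qAnti Q (1 ⊗ₜ[ℂ] X) (r ⊗ₜ[ℂ] Y) = r ⊗ₜ[ℂ] qAnti Q X Y := by
  simp only [qAnti, Algebra.TensorProduct.tmul_mul_tmul, mul_one, one_mul,
    TensorProduct.tmul_add, TensorProduct.tmul_smul]

theorem qAnti_tmul_tmul_one (r : S) (X Y : R) :
    qAnti Q (X ⊗ₜ[ℂ] r) (Y ⊗ₜ[ℂ] 1) = qAnti Q X Y ⊗ₜ[ℂ] r := by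
  simp only [qAnti, Algebra.TensorProduct.tmul_mul_tmul, mul_one, one_mul,
    TensorProduct.add_tmul, ← TensorProduct.smul_tmul']

/-- Centrality is required only inside the generated subalgebra, and the image of that subalgebra is
generated by the images. Hence no injectivity or surjectivity is needed. -/
theorem GenerateQBannaiIto.map {X Y Z α β γ : R} (h : GenerateQBannaiIto Q X Y Z α β γ)
    (F : R →ₐ[ℂ] S) : GenerateQBannaiIto Q (F X) (F Y) (F Z) (F α) (F β) (F γ) where
  rel_XY := by rw [← map_qAnti, h.rel_XY, map_add]
  rel_YZ := by rw [← map_qAnti, h.rel_YZ, map_add]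
  rel_ZX := by rw [← map_qAnti, h.rel_ZX, map_add]
  central w hw := by
    have e : Algebra.adjoin ℂ {F X, F Y, F Z} = (Algebra.adjoin ℂ {X, Y, Z}).map F := by
      rw [AlgHom.map_adjoin, Set.image_insert_eq, Set.image_insert_eq, Set.image_singleton]
    rw [e] at hw
    obtain ⟨w, hw, rfl⟩ := hw
    obtain ⟨h1, h2, h3⟩ := h.central w hw
    exact ⟨h1.map F, h2.map F, h3.map F⟩

end qAnti

/-! ### Centrality of the Casimir element. -/

section central
variable (Q : QParam)

theorem osp_induction {p : Osp Q → Prop} (hc : ∀ c : ℂ, p (algebraMap ℂ _ c))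
    (hg : ∀ g, p (gen Q g)) (hm : ∀ x y, p x → p y → p (x * y))
    (ha : ∀ x y, p x → p y → p (x + y)) (z : Osp Q) : p z := by
  obtain ⟨w, rfl⟩ := RingQuot.mkAlgHom_surjective ℂ (Rel Q) z
  induction w using FreeAlgebra.induction with
  | grade0 r => rw [AlgHom.commutes]; exact hc r
  | grade1 g => exact hg g
  | mul a b iha ihb => rw [map_mul]; exact hm _ _ iha ihb
  | add a b iha ihb => rw [map_add]; exact ha _ _ iha ihb

theorem casimir_commute (z : Osp Q) : Commute (casimir Q) z := by
  induction z using osp_induction with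
  | hc c => exact Algebra.commute_algebraMap_right c _
  | hg g =>
    cases g
    exacts [casimir_Ap Q, casimir_Am Q, casimir_K Q, casimir_Ki Q, casimir_P Q]
  | hm x y hx hy => exact hx.mul_right hy
  | ha x y hx hy => exact hx.add_right hy

theorem casI_commute (z : subI Q) : Commute (casI Q) z := Subtype.ext (casimir_commute Q z)

theorem commute_tmul_one {R S : Type} [Ring R] [Algebra ℂ R] [Ring S] [Algebra ℂ S] {r : R}
    (h : ∀ x, Commute r x) (z : R ⊗[ℂ] S) : Commute (r ⊗ₜ[ℂ] (1 : S)) z := by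
  induction z using TensorProduct.induction_on with
  | zero => exact Commute.zero_right _
  | tmul a b =>
    simp only [Commute, SemiconjBy, Algebra.TensorProduct.tmul_mul_tmul, one_mul, mul_one,
      (h a).eq]
  | add x y hx hy => exact hx.add_right hy

theorem commute_one_tmul {R S : Type} [Ring R] [Algebra ℂ R] [Ring S] [Algebra ℂ S] {r : S}
    (h : ∀ x, Commute r x) (z : R ⊗[ℂ] S) : Commute ((1 : R) ⊗ₜ[ℂ] r) z := by
  induction z using TensorProduct.induction_on with
  | zero => exact Commute.zero_right _
  | tmul a b =>
    simp only [Commute, SemiconjBy, Algebra.TensorProduct.tmul_mul_tmul, one_mul, mul_one,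
      (h b).eq]
  | add x y hx hy => exact hx.add_right hy

end central

/-! ### `Δ` and `τ` are left coactions on `𝓘`. -/

section coassociativity
variable (Q : QParam)

open TensorProduct

theorem subI_hom_ext {B : Type} [Ring B] [Algebra ℂ B] {F G : subI Q →ₐ[ℂ] B}
    (hx : F (xI Q) = G (xI Q)) (hy : F (yI Q) = G (yI Q)) (hk : F (kI Q) = G (kI Q))
    (hc : F (casI Q) = G (casI Q)) : F = G := by
  refine AlgHom.adjoin_ext (s := {xO Q, yO Q, kO Q, casimir Q}) fun z hz => ?_
  rcases hz with rfl | rfl | rfl | rfl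
  exacts [hx, hy, hk, hc]

/-- `f : 𝓘 → osp ⊗ 𝓘` is a left coaction: `(Δ ⊗ 1) f = (1 ⊗ f) f`. -/
def IsCoaction (f : subI Q →ₐ[ℂ] Osp Q ⊗[ℂ] subI Q) : Prop :=
  ∀ z, Algebra.TensorProduct.map (comul Q) (AlgHom.id ℂ (subI Q)) (f z) =
    (Algebra.TensorProduct.assoc ℂ ℂ ℂ (Osp Q) (Osp Q) (subI Q)).symm
      (Algebra.TensorProduct.map (AlgHom.id ℂ (Osp Q)) f (f z))

/-- Both sides of the coaction identity are algebra morphisms in `z`, so agreement on generators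
suffices. -/
theorem isCoaction_of_gen {f : subI Q →ₐ[ℂ] Osp Q ⊗[ℂ] subI Q}
    (h : ∀ z ∈ ({xI Q, yI Q, kI Q, casI Q} : Set (subI Q)),
      Algebra.TensorProduct.map (comul Q) (AlgHom.id ℂ (subI Q)) (f z) =
      (Algebra.TensorProduct.assoc ℂ ℂ ℂ (Osp Q) (Osp Q) (subI Q)).symm
        (Algebra.TensorProduct.map (AlgHom.id ℂ (Osp Q)) f (f z))) : IsCoaction Q f := by
  have e : (Algebra.TensorProduct.map (comul Q) (AlgHom.id ℂ (subI Q))).comp f =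
      ((Algebra.TensorProduct.assoc ℂ ℂ ℂ (Osp Q) (Osp Q) (subI Q)).symm.toAlgHom.comp
        (Algebra.TensorProduct.map (AlgHom.id ℂ (Osp Q)) f)).comp f := by
    apply subI_hom_ext <;> exact h _ (by simp)
  exact fun z => DFunLike.congr_fun e z

theorem isCoaction_comulI : IsCoaction Q (comulI Q) := by
  have h := Q.s_ne_zero
  have h1 := Q.s_sq_sub_one_ne_zero
  have h2 := Q.s_sq_add_one_ne_zero
  apply isCoaction_of_gen
  rintro z (rfl | rfl | rfl | rfl) <;>
  simp only [comulI_x, comulI_y, comulI_k, comulI_cas, map_add, map_sub, map_neg, map_smul, map_mul,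
    map_one,
    Algebra.TensorProduct.map_tmul, AlgHom.coe_id, id_eq, Algebra.TensorProduct.assoc_symm_tmul,
    Algebra.TensorProduct.one_def, comul_casimir_eq, comul_gen, comulGen,
    xO, yO, kO, pow_two, mul_add, add_mul, Algebra.TensorProduct.tmul_mul_tmul,
    mul_assoc, casimir_nf, mul_neg, neg_mul, mul_smul_comm, smul_mul_assoc, mul_one, one_mul,
    ← smul_tmul', tmul_smul, tmul_neg, neg_tmul, smul_smul, smul_add, smul_sub, smul_neg, neg_neg,
    mul_sub, sub_mul, tmul_sub, sub_tmul, tmul_add, add_tmul] <;>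
  match_scalars <;> field_simp

/-- Only the four values of `τ` on the generators enter, not its construction. The identity is what
allows a gap of several consecutive holes to be treated as one hole followed by coproducts. -/
theorem isCoaction_tau : IsCoaction Q (tau Q) := by
  have h := Q.s_ne_zero
  have h1 := Q.s_sq_sub_one_ne_zero
  have h2 := Q.s_sq_add_one_ne_zero
  apply isCoaction_of_gen
  rintro z (rfl | rfl | rfl | rfl) <;>
  simp only [tau_x, tau_y, tau_k, tau_casimir, map_add, map_sub, map_neg, map_smul, map_mul,
    map_one,
    Algebra.TensorProduct.map_tmul, AlgHom.coe_id, id_eq, Algebra.TensorProduct.assoc_symm_tmul,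
    Algebra.TensorProduct.one_def, comul_casimir_eq, comul_gen, comulGen,
    xO, yO, kO, pow_two, mul_add, add_mul, Algebra.TensorProduct.tmul_mul_tmul,
    mul_assoc, casimir_nf, mul_neg, neg_mul, mul_smul_comm, smul_mul_assoc, mul_one, one_mul,
    ← smul_tmul', tmul_smul, tmul_neg, neg_tmul, smul_smul, smul_add, smul_sub, smul_neg, neg_neg,
    mul_sub, sub_mul, tmul_sub, sub_tmul, tmul_add, add_tmul, Q.q_sub_inv, Q.s_sub_inv] <;>
  match_scalars <;> field_simp <;> ring

end coassociativity

/-! ### The rank 1 relations in `osp ⊗ osp ⊗ 𝓘`. -/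

section threeLegs
variable (Q : QParam)

open TensorProduct

noncomputable instance : Ring (Osp Q ⊗[ℂ] (Osp Q ⊗[ℂ] subI Q)) := inferInstance

noncomputable instance : Ring (Osp Q ⊗[ℂ] Osp Q ⊗[ℂ] subI Q) := inferInstance

/-- `Γ_{12}` in `osp ⊗ osp ⊗ 𝓘`. -/
noncomputable def cas12 : Osp Q ⊗[ℂ] (Osp Q ⊗[ℂ] subI Q) :=
  Algebra.TensorProduct.assoc ℂ ℂ ℂ (Osp Q) (Osp Q) (subI Q) (comul Q (casimir Q) ⊗ₜ 1)

/-- `Γ_{23}` in `osp ⊗ osp ⊗ 𝓘`. -/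
noncomputable def cas23 : Osp Q ⊗[ℂ] (Osp Q ⊗[ℂ] subI Q) := 1 ⊗ₜ comulI Q (casI Q)

/-- `Γ_{13}` in `osp ⊗ osp ⊗ 𝓘`. -/
noncomputable def cas13 : Osp Q ⊗[ℂ] (Osp Q ⊗[ℂ] subI Q) :=
  Algebra.TensorProduct.map (AlgHom.id ℂ (Osp Q)) (tau Q) (comulI Q (casI Q))

/-- `Γ_{123}` in `osp ⊗ osp ⊗ 𝓘`. -/
noncomputable def cas123 : Osp Q ⊗[ℂ] (Osp Q ⊗[ℂ] subI Q) :=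
  Algebra.TensorProduct.map (AlgHom.id ℂ (Osp Q)) (comulI Q) (comulI Q (casI Q))

/-- `Γ_1` in `osp ⊗ osp ⊗ 𝓘`. -/
noncomputable def cas1 : Osp Q ⊗[ℂ] (Osp Q ⊗[ℂ] subI Q) := casimir Q ⊗ₜ 1

/-- `Γ_2` in `osp ⊗ osp ⊗ 𝓘`. -/
noncomputable def cas2 : Osp Q ⊗[ℂ] (Osp Q ⊗[ℂ] subI Q) := 1 ⊗ₜ (casimir Q ⊗ₜ 1)

/-- `Γ_3` in `osp ⊗ osp ⊗ 𝓘`. -/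
noncomputable def cas3 : Osp Q ⊗[ℂ] (Osp Q ⊗[ℂ] subI Q) := 1 ⊗ₜ (1 ⊗ₜ casI Q)

theorem cas1_commute (z) : Commute (cas1 Q) z := commute_tmul_one (casimir_commute Q) z

theorem cas2_commute (z) : Commute (cas2 Q) z :=
  commute_one_tmul (commute_tmul_one (casimir_commute Q)) z

theorem cas3_commute (z) : Commute (cas3 Q) z :=
  commute_one_tmul (commute_one_tmul (casI_commute Q)) z

/-- By coassociativity the total Casimir also lies in the image of `Δ ⊗ 1`. This is the form needed
to compare it with `Γ_{12}`. -/
theorem cas123_eq : cas123 Q = Algebra.TensorProduct.assoc ℂ ℂ ℂ (Osp Q) (Osp Q) (subI Q)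
    (Algebra.TensorProduct.map (comul Q) (AlgHom.id ℂ (subI Q)) (comulI Q (casI Q))) := by
  rw [isCoaction_comulI, AlgEquiv.apply_symm_apply, cas123]

/-- Both elements are images under `Δ ⊗ 1`, of `Δ(Γ)` and of the central element `Γ ⊗ 1`
respectively. -/
theorem cas123_commute_cas12 : Commute (cas123 Q) (cas12 Q) := by
  have h : Commute (comulI Q (casI Q)) (casimir Q ⊗ₜ 1) :=
    (commute_tmul_one (casimir_commute Q) _).symm
  have := (h.map (Algebra.TensorProduct.map (comul Q) (AlgHom.id ℂ (subI Q)))).map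
    (Algebra.TensorProduct.assoc ℂ ℂ ℂ (Osp Q) (Osp Q) (subI Q))
  rwa [← cas123_eq, Algebra.TensorProduct.map_tmul, map_one] at this

theorem cas123_commute_cas23 : Commute (cas123 Q) (cas23 Q) := by
  have h : Commute (comulI Q (casI Q)) (1 ⊗ₜ casI Q) :=
    (commute_one_tmul (casI_commute Q) _).symm
  have := h.map (Algebra.TensorProduct.map (AlgHom.id ℂ (Osp Q)) (comulI Q))
  rwa [Algebra.TensorProduct.map_tmul, map_one] at this

theorem cas12_expand : cas12 Q =
    -(Q.s • ((Am Q * Ki Q * P Q) ⊗ₜ (yO Q ⊗ₜ 1))) + Q.s⁻¹ • ((Ap Q * Ki Q * P Q) ⊗ₜ (xO Q ⊗ₜ 1))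
      + (Q.s + Q.s⁻¹)⁻¹ • ((Ki Q ^ 2 * P Q) ⊗ₜ (kO Q ⊗ₜ 1)) + casimir Q ⊗ₜ (kO Q ⊗ₜ 1)
      + (Ki Q ^ 2 * P Q) ⊗ₜ (casimir Q ⊗ₜ 1) := by
  simp only [cas12, comul_casimir_eq, add_tmul, neg_tmul, ← smul_tmul', map_add, map_neg,
    map_smul, Algebra.TensorProduct.assoc_tmul]

/-- One expansion covers `Γ_{13}` (`f = τ`) and `Γ_{123}` (`f = Δ`), so both have the same first-leg
coefficients as `Γ_{12}` and the rows can be summed term by term. -/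
theorem map_comulI_cas (f : subI Q →ₐ[ℂ] Osp Q ⊗[ℂ] subI Q) :
    Algebra.TensorProduct.map (AlgHom.id ℂ (Osp Q)) f (comulI Q (casI Q)) =
    -(Q.s • ((Am Q * Ki Q * P Q) ⊗ₜ f (yI Q))) + Q.s⁻¹ • ((Ap Q * Ki Q * P Q) ⊗ₜ f (xI Q))
      + (Q.s + Q.s⁻¹)⁻¹ • ((Ki Q ^ 2 * P Q) ⊗ₜ f (kI Q)) + casimir Q ⊗ₜ f (kI Q)
      + (Ki Q ^ 2 * P Q) ⊗ₜ f (casI Q) := by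
  simp only [comulI_cas, map_add, map_neg, map_smul, Algebra.TensorProduct.map_tmul,
    AlgHom.coe_id, id_eq]

/-- `Γ_{23}` has a unit in the first leg, so the first-leg coefficients of `Γ_{12}` pass through and
each term reduces to a two-leg row. The extra `1 ⊗ Γ` in the row of `K² P` occurs with two
coefficients: `(s + s⁻¹)⁻¹ K⁻² P` completes `Γ_{13}`, while `Γ` yields `Γ_1 Γ_3`. -/
theorem qAnti_cas12_cas23 : qAnti Q (cas12 Q) (cas23 Q) = cas13 Q +
    (Q.s + Q.s⁻¹) • (cas2 Q * cas123 Q + cas1 Q * cas3 Q) := by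
  have h := Q.s_ne_zero
  have h2 := Q.s_sq_add_one_ne_zero
  have hc : qAnti Q (casimir Q ⊗ₜ (1 : subI Q)) (comulI Q (casI Q)) = _ :=
    qAnti_of_commute Q (commute_tmul_one (casimir_commute Q) _)
  rw [cas12_expand, cas13, cas123, map_comulI_cas, map_comulI_cas, cas23, cas1, cas2, cas3]
  simp only [qAnti_add_left, qAnti_neg_left, qAnti_smul_left, qAnti_tmul_one_tmul, hc,
    qAnti_tmul_one_x, qAnti_tmul_one_y, qAnti_tmul_one_k, tau_casimir, mul_add, mul_neg,
    mul_smul_comm, Algebra.TensorProduct.tmul_mul_tmul, one_mul, mul_one, tmul_add, tmul_smul]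
  match_scalars <;> field_simp

/-- The first-leg argument applies again, with the rows for `τ(v)`. The extra `Γ ⊗ 1` in the row of
`K² P` completes `Γ_{12}` and yields `Γ_1 Γ_2`. -/
theorem qAnti_cas23_cas13 : qAnti Q (cas23 Q) (cas13 Q) = cas12 Q +
    (Q.s + Q.s⁻¹) • (cas3 Q * cas123 Q + cas2 Q * cas1 Q) := by
  have h := Q.s_ne_zero
  have h2 := Q.s_sq_add_one_ne_zero
  have hc : qAnti Q (comulI Q (casI Q)) (tau Q (casI Q)) =
      (Q.s + Q.s⁻¹) • ((1 ⊗ₜ casI Q) * comulI Q (casI Q)) := by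
    have := commute_one_tmul (R := Osp Q) (casI_commute Q) (comulI Q (casI Q))
    rw [tau_casimir, qAnti_of_commute Q this.symm, this.eq]
  rw [cas12_expand, cas13, cas123, map_comulI_cas, map_comulI_cas, cas23, cas1, cas2, cas3]
  simp only [qAnti_add_right, qAnti_neg_right, qAnti_smul_right, qAnti_one_tmul_tmul, hc,
    qAnti_tau_x, qAnti_tau_y, qAnti_tau_k, mul_add, mul_neg,
    mul_smul_comm, Algebra.TensorProduct.tmul_mul_tmul, one_mul, mul_one, tmul_add, tmul_smul]
  match_scalars <;> field_simp

/-- Neither entry has a unit in the first leg, but `Γ_{12}` has one in the last. After rebracketing,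
the last leg of `Γ_{13}` passes through and its coefficients `q`-anticommute with `Δ(Γ)` in `osp ⊗
osp`. -/
theorem qAnti_cas13_cas12 : qAnti Q (cas13 Q) (cas12 Q) = cas23 Q +
    (Q.s + Q.s⁻¹) • (cas1 Q * cas123 Q + cas3 Q * cas2 Q) := by
  have h := Q.s_ne_zero
  have h1 := Q.s_sq_sub_one_ne_zero
  have h2 := Q.s_sq_add_one_ne_zero
  set α := Algebra.TensorProduct.assoc ℂ ℂ ℂ (Osp Q) (Osp Q) (subI Q) with hα
  -- `tx` and `tc` are the coefficients of `A_- K` and `Γ` in the last leg of `Γ_{13}`, and `-s •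
  -- ty` is that of `A_+ K`. The coefficient of `K² P` needs no new element: since `s - s⁻¹ = (q -
  -- q⁻¹)/(s + s⁻¹)`, it is `(s + s⁻¹)⁻¹ tc + Γ ⊗ 1`.
  set tx : Osp Q ⊗[ℂ] Osp Q := -((Q.q - Q.q⁻¹) • ((Am Q * Ki Q * P Q) ⊗ₜ (Ap Q ^ 2 * P Q))) +
      Q.s⁻¹ • ((Ap Q * Ki Q * P Q) ⊗ₜ kO Q) -
      (Q.s - Q.s⁻¹) • ((Ki Q ^ 2 * P Q) ⊗ₜ yO Q) - (Q.q - Q.q⁻¹) • (casimir Q ⊗ₜ yO Q) with htx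
  set tc : Osp Q ⊗[ℂ] Osp Q :=
    -((Q.q - Q.q⁻¹) • ((Am Q * Ki Q * P Q) ⊗ₜ (Ap Q * Ki Q * P Q))) +
      (Ki Q ^ 2 * P Q) ⊗ₜ 1 with htc
  set ty : Osp Q ⊗[ℂ] Osp Q := (Am Q * Ki Q * P Q) ⊗ₜ (Ki Q ^ 2 * P Q) with hty
  have hx := qAnti_leg_x Q
  have hy := qAnti_leg_y Q
  have hk := qAnti_leg_cas Q
  rw [← htx] at hx
  rw [← hty] at hy
  rw [← htc] at hk
  have hc : qAnti Q (casimir Q ⊗ₜ (1 : Osp Q)) (comul Q (casimir Q)) = _ :=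
    qAnti_of_commute Q (commute_tmul_one (casimir_commute Q) _)
  have e13 : cas13 Q = α (-(Q.s • ty ⊗ₜ yI Q) + tx ⊗ₜ xI Q +
      ((Q.s + Q.s⁻¹)⁻¹ • tc + casimir Q ⊗ₜ 1) ⊗ₜ kI Q + tc ⊗ₜ casI Q) := by
    rw [cas13, map_comulI_cas, htx, hty, htc, tau_x, tau_y, tau_k, tau_casimir]
    simp only [add_tmul, neg_tmul, sub_tmul, ← smul_tmul', map_add, map_neg, map_sub, map_smul,
      hα, Algebra.TensorProduct.assoc_tmul, tmul_add, tmul_sub, tmul_smul, smul_add, smul_sub,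
      smul_smul, yO, kO, Q.q_sub_inv, Q.s_sub_inv]
    match_scalars <;> field_simp
  have e23 : cas23 Q = α (-(Q.s • (1 ⊗ₜ (Am Q * Ki Q * P Q)) ⊗ₜ yI Q) +
      Q.s⁻¹ • (1 ⊗ₜ (Ap Q * Ki Q * P Q)) ⊗ₜ xI Q +
      (Q.s + Q.s⁻¹)⁻¹ • (1 ⊗ₜ (Ki Q ^ 2 * P Q)) ⊗ₜ kI Q + (1 ⊗ₜ casimir Q) ⊗ₜ kI Q +
      (1 ⊗ₜ (Ki Q ^ 2 * P Q)) ⊗ₜ casI Q) := by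
    rw [cas23, comulI_cas]
    simp only [map_add, map_neg, map_smul, hα, Algebra.TensorProduct.assoc_tmul, tmul_add,
      tmul_neg, tmul_smul]
  have e1 : cas1 Q = α ((casimir Q ⊗ₜ 1) ⊗ₜ 1) := by
    rw [hα, Algebra.TensorProduct.assoc_tmul, cas1, Algebra.TensorProduct.one_def]
  have e2 : cas2 Q = α ((1 ⊗ₜ casimir Q) ⊗ₜ 1) := by
    rw [hα, Algebra.TensorProduct.assoc_tmul, cas2]
  have e3 : cas3 Q = α (1 ⊗ₜ casI Q) := by
    rw [Algebra.TensorProduct.one_def, hα, Algebra.TensorProduct.assoc_tmul, cas3]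
  have e123 : cas123 Q = α _ := cas123_eq Q
  have e12 : cas12 Q = α (comul Q (casimir Q) ⊗ₜ 1) := rfl
  have hmap : ∀ X Y, α (qAnti Q X Y) = qAnti Q (α X) (α Y) := map_qAnti Q α.toAlgHom
  rw [e13, e12, ← hmap, e23, e1, e2, e3, e123, ← map_mul, ← map_mul, ← map_add, ← map_smul,
    ← map_add]
  congr 1
  simp only [qAnti_add_left, qAnti_neg_left, qAnti_smul_left, qAnti_tmul_tmul_one, hc, hx, hy, hk,
    comulI_cas, map_add, map_neg, map_smul, Algebra.TensorProduct.map_tmul, AlgHom.coe_id, id_eq,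
    mul_add, mul_neg, mul_smul_comm, Algebra.TensorProduct.tmul_mul_tmul, one_mul, mul_one,
    add_tmul, neg_tmul, ← smul_tmul']
  match_scalars <;> field_simp

theorem generateQBannaiIto_threeLegs : GenerateQBannaiIto Q (cas12 Q) (cas23 Q) (cas13 Q)
    ((Q.s + Q.s⁻¹) • (cas2 Q * cas123 Q + cas1 Q * cas3 Q))
    ((Q.s + Q.s⁻¹) • (cas3 Q * cas123 Q + cas2 Q * cas1 Q))
    ((Q.s + Q.s⁻¹) • (cas1 Q * cas123 Q + cas3 Q * cas2 Q)) where
  rel_XY := qAnti_cas12_cas23 Q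
  rel_YZ := qAnti_cas23_cas13 Q
  rel_ZX := qAnti_cas13_cas12 Q
  central w hw := by
    have h12 := cas123_commute_cas12 Q
    have h23 := cas123_commute_cas23 Q
    have h13 : Commute (cas123 Q) (cas13 Q) := by
      -- The first relation writes `Γ_{13}` as a polynomial in `Γ_{12}`, `Γ_{23}`, `Γ_{123}` and
      -- central elements.
      rw [eq_sub_of_add_eq (qAnti_cas12_cas23 Q).symm, qAnti]
      refine (((h12.mul_right h23).smul_right _).add_right
        ((h23.mul_right h12).smul_right _)).sub_right (Commute.smul_right (Commute.add_right ?_ ?_) _)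
      · exact (cas2_commute Q _).symm.mul_right (Commute.refl _)
      · exact (cas1_commute Q _).symm.mul_right (cas3_commute Q _).symm
    have h : Commute (cas123 Q) w := by
      induction hw using Algebra.adjoin_induction with
      | mem z hz =>
        rcases hz with rfl | rfl | rfl
        exacts [h12, h23, h13]
      | algebraMap c => exact Algebra.commute_algebraMap_right c _
      | add x y _ _ hx hy => exact hx.add_right hy
      | mul x y _ _ hx hy => exact hx.mul_right hy
    refine ⟨?_, ?_, ?_⟩ <;> refine Commute.smul_left (Commute.add_left ?_ ?_) _
    · exact (cas2_commute Q w).mul_left h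
    · exact (cas1_commute Q w).mul_left (cas3_commute Q w)
    · exact (cas3_commute Q w).mul_left h
    · exact (cas2_commute Q w).mul_left (cas1_commute Q w)
    · exact (cas1_commute Q w).mul_left h
    · exact (cas3_commute Q w).mul_left (cas2_commute Q w)

end threeLegs
end QBI

namespace QBI

/-! ### Operations on the last legs of a tensor power. -/

section legs
variable (Q : QParam)

open TensorProduct

/-- `osp^{⊗ p} ⊗ (osp ⊗ 𝓘) → osp^{⊗ (p+1)} ⊗ 𝓘`. -/
noncomputable def joinLeg (p : ℕ) :
    TensorPow Q p ⊗[ℂ] (Osp Q ⊗[ℂ] subI Q) →ₐ[ℂ] TensorPow Q (p + 1) ⊗[ℂ] subI Q :=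
  (Algebra.TensorProduct.map (tensorPowSucc Q p : _ →ₐ[ℂ] _) (AlgHom.id ℂ (subI Q))).comp
    (Algebra.TensorProduct.assoc ℂ ℂ ℂ (TensorPow Q p) (Osp Q) (subI Q)).symm.toAlgHom

/-- `osp^{⊗ p} ⊗ (osp ⊗ osp) → osp^{⊗ (p+2)}`. -/
noncomputable def joinTwo (p : ℕ) :
    TensorPow Q p ⊗[ℂ] (Osp Q ⊗[ℂ] Osp Q) →ₐ[ℂ] TensorPow Q (p + 2) :=
  (tensorPowSucc Q (p + 1)).toAlgHom.comp
    ((Algebra.TensorProduct.map (tensorPowSucc Q p : _ →ₐ[ℂ] _) (AlgHom.id ℂ (Osp Q))).comp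
      (Algebra.TensorProduct.assoc ℂ ℂ ℂ (TensorPow Q p) (Osp Q) (Osp Q)).symm.toAlgHom)

/-- The inclusion `osp^{⊗ p} ⊗ 𝓘 → osp^{⊗ (p+1)}`. -/
noncomputable def inclLast (p : ℕ) : TensorPow Q p ⊗[ℂ] subI Q →ₐ[ℂ] TensorPow Q (p + 1) :=
  (tensorPowSucc Q p).toAlgHom.comp (inclI Q (TensorPow Q p))

theorem joinLeg_tmul (p : ℕ) (w : TensorPow Q p) (a : Osp Q) (c : subI Q) :
    joinLeg Q p (w ⊗ₜ (a ⊗ₜ c)) = tensorPowSucc Q p (w ⊗ₜ a) ⊗ₜ c := rfl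

theorem lastLeg_tmul (p : ℕ) (f : subI Q →ₐ[ℂ] Osp Q ⊗[ℂ] subI Q) (w : TensorPow Q p)
    (c : subI Q) : lastLeg Q p f (w ⊗ₜ c) = joinLeg Q p (w ⊗ₜ f c) := rfl

theorem comulLast_succ (p : ℕ) (w : TensorPow Q p) (a : Osp Q) :
    comulLast Q p (tensorPowSucc Q p (w ⊗ₜ a)) = joinTwo Q p (w ⊗ₜ comul Q a) := rfl

theorem inclLast_tmul (p : ℕ) (w : TensorPow Q p) (c : subI Q) :
    inclLast Q p (w ⊗ₜ c) = tensorPowSucc Q p (w ⊗ₜ (c : Osp Q)) := rfl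

theorem tensorPowSucc_one (p : ℕ) : tensorPowSucc Q p (1 ⊗ₜ 1) = 1 := by
  rw [← Algebra.TensorProduct.one_def, map_one]

/-- The right side has the same outer shape as in `lastLeg_joinLeg`: the prefix `w` is inert and all
the action takes place in `osp ⊗ osp ⊗ 𝓘`. The coaction identity can then be substituted inside. -/
theorem comulPenultimate_joinLeg (p : ℕ) (w : TensorPow Q p) (u : Osp Q ⊗[ℂ] subI Q) :
    comulPenultimate Q p (joinLeg Q p (w ⊗ₜ u)) =
      Algebra.TensorProduct.map (joinTwo Q p) (AlgHom.id ℂ (subI Q))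
        ((Algebra.TensorProduct.assoc ℂ ℂ ℂ (TensorPow Q p) (Osp Q ⊗[ℂ] Osp Q) (subI Q)).symm
          (w ⊗ₜ Algebra.TensorProduct.map (comul Q) (AlgHom.id ℂ (subI Q)) u)) := by
  induction u using TensorProduct.induction_on with
  | zero => simp only [tmul_zero, map_zero]
  | tmul a c => rfl
  | add x y hx hy => simp only [tmul_add, map_add, hx, hy]

theorem lastLeg_joinLeg (p : ℕ) (f : subI Q →ₐ[ℂ] Osp Q ⊗[ℂ] subI Q) (w : TensorPow Q p)
    (u : Osp Q ⊗[ℂ] subI Q) :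
    lastLeg Q (p + 1) f (joinLeg Q p (w ⊗ₜ u)) =
      Algebra.TensorProduct.map (joinTwo Q p) (AlgHom.id ℂ (subI Q))
        ((Algebra.TensorProduct.assoc ℂ ℂ ℂ (TensorPow Q p) (Osp Q ⊗[ℂ] Osp Q) (subI Q)).symm
          (w ⊗ₜ (Algebra.TensorProduct.assoc ℂ ℂ ℂ (Osp Q) (Osp Q) (subI Q)).symm
            (Algebra.TensorProduct.map (AlgHom.id ℂ (Osp Q)) f u))) := by
  induction u using TensorProduct.induction_on with
  | zero => simp only [tmul_zero, map_zero]
  | tmul a c =>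
    rw [joinLeg_tmul, lastLeg_tmul, Algebra.TensorProduct.map_tmul, AlgHom.coe_id, id_eq]
    induction f c using TensorProduct.induction_on with
    | zero => simp only [tmul_zero, map_zero]
    | tmul b d => rfl
    | add x y hx hy => simp only [tmul_add, map_add, hx, hy]
  | add x y hx hy => simp only [tmul_add, map_add, hx, hy]

theorem comulPenultimate_lastLeg {f : subI Q →ₐ[ℂ] Osp Q ⊗[ℂ] subI Q} (hf : IsCoaction Q f)
    (p : ℕ) (z : TensorPow Q p ⊗[ℂ] subI Q) :
    comulPenultimate Q p (lastLeg Q p f z) = lastLeg Q (p + 1) f (lastLeg Q p f z) := by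
  induction z using TensorProduct.induction_on with
  | zero => simp only [map_zero]
  | tmul w c => rw [lastLeg_tmul, comulPenultimate_joinLeg, lastLeg_joinLeg, hf]
  | add x y hx hy => simp only [map_add, hx, hy]

/-- On `𝓘` the coaction `Δ` is the restriction of the coproduct. At a position of the set, the chain
viewed in `osp` is thus extended by the ordinary coproduct. -/
theorem inclLast_lastLeg_comulI (p : ℕ) (z : TensorPow Q p ⊗[ℂ] subI Q) :
    inclLast Q (p + 1) (lastLeg Q p (comulI Q) z) = comulLast Q p (inclLast Q p z) := by
  induction z using TensorProduct.induction_on with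
  | zero => simp only [map_zero]
  | tmul w c =>
    rw [lastLeg_tmul, inclLast_tmul, comulLast_succ, ← inclI_comulI]
    induction comulI Q c using TensorProduct.induction_on with
    | zero => simp only [tmul_zero, map_zero]
    | tmul b d => rfl
    | add x y hx hy => simp only [tmul_add, map_add, hx, hy]
  | add x y hx hy => simp only [map_add, hx, hy]

theorem lastLeg_tmul_one (p : ℕ) (f : subI Q →ₐ[ℂ] Osp Q ⊗[ℂ] subI Q) (w : TensorPow Q p) :
    lastLeg Q p f (w ⊗ₜ 1) = tensorPowSucc Q p (w ⊗ₜ 1) ⊗ₜ 1 := by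
  rw [lastLeg_tmul, map_one]; rfl

end legs

/-! ### Extension by one coaction per position, and spreading of blocks. -/

section uniformChain
variable (Q : QParam)

open TensorProduct

/-- The coaction applied to the last leg at a position inside (`true`) or outside (`false`) of the
set that indexes an intermediate Casimir element. -/
noncomputable def legHom : Bool → subI Q →ₐ[ℂ] Osp Q ⊗[ℂ] subI Q
  | true => comulI Q
  | false => tau Q

theorem isCoaction_legHom : ∀ b, IsCoaction Q (legHom Q b)
  | true => isCoaction_comulI Q
  | false => isCoaction_tau Q

/-- A uniform variant of `chain`, in which the leg in `𝓘` is always at the position `p + 1`. -/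
noncomputable def uniformChain (S : Finset ℕ) : (p : ℕ) → TensorPow Q p ⊗[ℂ] subI Q
  | 0 => 1 ⊗ₜ casI Q
  | p + 1 => lastLeg Q p (legHom Q (decide (p + 1 ∈ S))) (uniformChain S p)

theorem lastLeg_tau_one_tmul (p : ℕ) :
    lastLeg Q p (tau Q) (1 ⊗ₜ casI Q) = 1 ⊗ₜ casI Q := by
  rw [lastLeg_tmul, tau_casimir, joinLeg_tmul, tensorPowSucc_one]

/-- Because `τ` fixes `Γ` up to a unit in front, holes before the minimum only insert units. The
uniform chain can therefore start at position 1 for every set, with no reference to its minimum. -/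
theorem uniformChain_of_notMem (S : Finset ℕ) (p : ℕ) (h : ∀ k ≤ p, 1 ≤ k → k ∉ S) :
    uniformChain Q S p = 1 ⊗ₜ casI Q := by
  induction p with
  | zero => rfl
  | succ p ih =>
    rw [uniformChain, ih fun k hk => h k (by omega), decide_eq_false (h _ le_rfl (by omega))]
    exact lastLeg_tau_one_tmul Q p

theorem uniformChain_succ_succ (S : Finset ℕ) (p : ℕ)
    (h : decide (p + 1 ∈ S) = decide (p + 2 ∈ S)) :
    uniformChain Q S (p + 2) = comulPenultimate Q p (uniformChain Q S (p + 1)) := by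
  rw [uniformChain, uniformChain, ← h, comulPenultimate_lastLeg Q (isCoaction_legHom Q _)]

/-- The morphism that turns `uniformChain` into `chain`. -/
noncomputable def holeLeg : (b : Bool) → (p : ℕ) →
    (TensorPow Q p ⊗[ℂ] subI Q →ₐ[ℂ] TensorPow Q (legs b p) ⊗[ℂ] subI Q)
  | true, p => AlgHom.id ℂ (TensorPow Q p ⊗[ℂ] subI Q)
  | false, p => lastLeg Q p (tau Q)

theorem holeLeg_one_tmul : ∀ (b : Bool) (p : ℕ),
    holeLeg Q b p (1 ⊗ₜ casI Q) = 1 ⊗ₜ casI Q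
  | true, _ => rfl
  | false, p => lastLeg_tau_one_tmul Q p

/-- At a hole, the original chain has already applied the `τ` of that position, so it is one step
ahead; leaving a gap then requires the identity. The one case with content is hole after hole, where
a coproduct on the penultimate leg replaces a further `τ` by the coaction property. -/
theorem extend_holeLeg : ∀ (b b' : Bool) (p : ℕ) (z : TensorPow Q p ⊗[ℂ] subI Q),
    extend Q b b' p (holeLeg Q b p z) = holeLeg Q b' (p + 1) (lastLeg Q p (legHom Q b) z)
  | true, true, _, _ => rfl
  | true, false, _, _ => rfl
  | false, true, _, _ => rfl
  | false, false, p, z => comulPenultimate_lastLeg Q (isCoaction_tau Q) p z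

theorem chain_eq_holeLeg (S : Finset ℕ) (a : ℕ) (ha : ∀ k < a, k ∉ S) (p : ℕ) :
    chain Q S a p = holeLeg Q (decide (p + 1 ∈ S)) p (uniformChain Q S p) := by
  induction p with
  | zero => exact (holeLeg_one_tmul Q _ 0).symm
  | succ p ih =>
    rw [chain]
    split_ifs with h
    · rw [uniformChain_of_notMem Q S (p + 1) fun k hk _ => ha k (by omega), holeLeg_one_tmul]
    · rw [ih, extend_holeLeg]
      rfl

theorem forgetI_holeLeg : ∀ (b : Bool) (p : ℕ) (z : TensorPow Q p ⊗[ℂ] subI Q), b = true →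
    forgetI Q b p (holeLeg Q b p z) = inclLast Q p z
  | true, _, _, _ => rfl

theorem Gam_eq_inclLast (S : Finset ℕ) (p : ℕ) (hp : p + 1 ∈ S) (hS : ∀ k ∈ S, k ≤ p + 1) :
    Gam Q (p + 1) S = inclLast Q p (uniformChain Q S p) := by
  have hne : S.Nonempty := ⟨_, hp⟩
  have hmax : S.max' hne = p + 1 :=
    le_antisymm (S.max'_le hne _ hS) (S.le_max' _ hp)
  rw [Gam, dif_pos hne, hmax, padded, if_pos rfl, chain_eq_holeLeg, forgetI_holeLeg]
  · exact decide_eq_true hp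
  · exact fun k hk hkS => absurd (S.min'_le k hkS) (by omega)

theorem Gam_succ (S : Finset ℕ) (n : ℕ) (hne : S.Nonempty) (hS : ∀ k ∈ S, k ≤ n) :
    Gam Q (n + 1) S = tensorPowSucc Q n (Gam Q n S ⊗ₜ 1) := by
  have hmax : S.max' hne ≤ n := S.max'_le hne _ hS
  rw [Gam, dif_pos hne, Gam, dif_pos hne, padded, if_neg (by omega)]

/-- The order of the quantifiers matters: one morphism, the insertion of units at the end, must
serve all `S` so that relations between different Casimirs are transported. The same holds for the
existence lemmas below. -/
theorem exists_padding {n r : ℕ} (h : n ≤ r) : ∃ E : TensorPow Q n →ₐ[ℂ] TensorPow Q r,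
    ∀ S : Finset ℕ, S.Nonempty → (∀ k ∈ S, k ≤ n) → E (Gam Q n S) = Gam Q r S := by
  induction r, h using Nat.le_induction with
  | base => exact ⟨AlgHom.id ℂ _, fun S _ _ => rfl⟩
  | succ r hr ih =>
    obtain ⟨E, hE⟩ := ih
    refine ⟨((tensorPowSucc Q r).toAlgHom.comp Algebra.TensorProduct.includeLeft).comp E,
      fun S hne hS => ?_⟩
    rw [Gam_succ Q S r hne fun k hk => (hS k hk).trans hr, ← hE S hne hS]
    rfl

/-- Beyond `j` the uniform chain depends on the set only through its elements there, which are those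
of `T`. Sets contained in `[1, j]` do not use the leg in `𝓘`, and each coaction merely turns its
unit into two units. -/
theorem exists_extension (T : Finset ℕ) {j r : ℕ} (h : j ≤ r) :
    ∃ F : TensorPow Q j ⊗[ℂ] subI Q →ₐ[ℂ] TensorPow Q r ⊗[ℂ] subI Q,
      (∀ S : Finset ℕ, (∀ k ≤ r, j < k → (k ∈ S ↔ k ∈ T)) →
        F (uniformChain Q S j) = uniformChain Q S r) ∧
      ∀ S : Finset ℕ, S.Nonempty → (∀ k ∈ S, k ≤ j) →
        F (Gam Q j S ⊗ₜ 1) = Gam Q r S ⊗ₜ 1 := by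
  induction r, h using Nat.le_induction with
  | base => exact ⟨AlgHom.id ℂ _, fun S _ => rfl, fun S _ _ => rfl⟩
  | succ r hr ih =>
    obtain ⟨F, hF, hF'⟩ := ih
    refine ⟨(lastLeg Q r (legHom Q (decide (r + 1 ∈ T)))).comp F, fun S hS => ?_,
      fun S hne hS => ?_⟩
    · have e : decide (r + 1 ∈ T) = decide (r + 1 ∈ S) :=
        decide_eq_decide.2 (hS (r + 1) le_rfl (by omega)).symm
      rw [AlgHom.comp_apply, hF S fun k hk => hS k (by omega), uniformChain, e]
    · rw [AlgHom.comp_apply, hF' S hne hS, lastLeg_tmul_one,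
        Gam_succ Q S r hne fun k hk => (hS k hk).trans hr]

/-- The image in `osp^{⊗ p}` of the uniform chain with the leg in `𝓘` at the position `p`. -/
noncomputable def uniformCas (S : Finset ℕ) : (p : ℕ) → TensorPow Q p
  | 0 => 0
  | p + 1 => inclLast Q p (uniformChain Q S p)

theorem uniformCas_succ_succ (S : Finset ℕ) (p : ℕ) (h : p + 1 ∈ S) :
    uniformCas Q S (p + 2) = comulLast Q p (uniformCas Q S (p + 1)) := by
  rw [uniformCas, uniformCas, uniformChain, decide_eq_true h]
  exact inclLast_lastLeg_comulI Q p _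

theorem Gam_eq_uniformCas (S : Finset ℕ) {p : ℕ} (h0 : p ≠ 0) (hp : p ∈ S)
    (hS : ∀ k ∈ S, k ≤ p) : Gam Q p S = uniformCas Q S p := by
  obtain ⟨p, rfl⟩ := Nat.exists_eq_succ_of_ne_zero h0
  exact Gam_eq_inclLast Q S p hp hS

/-- `D` puts `a` units in front and spreads one leg over `(a, p]` by iterated coproducts. By the
coaction property it depends neither on `S` nor on `b`. -/
theorem exists_block {a p : ℕ} (h : a + 1 ≤ p) : ∃ D : Osp Q →ₐ[ℂ] TensorPow Q p,
    ∀ S : Finset ℕ, (∀ k ≤ a, 1 ≤ k → k ∉ S) →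
      (∀ b, (∀ k ≤ p, a < k → decide (k ∈ S) = b) →
        uniformChain Q S p =
          Algebra.TensorProduct.map D (AlgHom.id ℂ (subI Q)) (legHom Q b (casI Q))) ∧
      ((∀ k ≤ p, a < k → k ∈ S) → uniformCas Q S p = D (casimir Q)) := by
  induction p, h using Nat.le_induction with
  | base =>
    refine ⟨(tensorPowSucc Q a).toAlgHom.comp Algebra.TensorProduct.includeRight,
      fun S hS => ⟨fun b hb => ?_, fun _ => ?_⟩⟩
    · rw [uniformChain, uniformChain_of_notMem Q S a hS, hb _ le_rfl (by omega), lastLeg_tmul]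
      induction legHom Q b (casI Q) using TensorProduct.induction_on with
      | zero => simp only [tmul_zero, map_zero]
      | tmul b d => rfl
      | add x y hx hy => simp only [tmul_add, map_add, hx, hy]
    · rw [uniformCas, uniformChain_of_notMem Q S a hS]
      rfl
  | succ p hp ih =>
    obtain ⟨D, hD⟩ := ih
    obtain ⟨p, rfl⟩ := Nat.exists_eq_succ_of_ne_zero (show p ≠ 0 by omega)
    refine ⟨(comulLast Q p).comp D, fun S hS => ⟨fun b hb => ?_, fun h => ?_⟩⟩
    · rw [uniformChain_succ_succ, (hD S hS).1 b fun k hk => hb k (by omega), comulPenultimate,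
        ← AlgHom.comp_apply, ← Algebra.TensorProduct.map_comp]
      · rfl
      · rw [hb _ (by omega) (by omega), hb _ (by omega) (by omega)]
    · rw [uniformCas_succ_succ Q S p (h _ (by omega) (by omega)),
        (hD S hS).2 fun k hk => h k (by omega)]
      rfl

/-- `ψ` is `D` on the first leg and iterated coproducts over `(m, p]` on the second. The four
clauses cover the chains that continue beyond `p`, and the Casimirs of both blocks, of the second
and of the first, which end within `[1, p]`. -/
theorem exists_twoBlocks {m p : ℕ} (h : m + 1 ≤ p) (D : Osp Q →ₐ[ℂ] TensorPow Q m) :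
    ∃ ψ : Osp Q ⊗[ℂ] Osp Q →ₐ[ℂ] TensorPow Q p,
      (∀ (S : Finset ℕ) (b b' : Bool), uniformChain Q S m =
          Algebra.TensorProduct.map D (AlgHom.id ℂ (subI Q)) (legHom Q b (casI Q)) →
        (∀ k ≤ p, m < k → decide (k ∈ S) = b') →
        Algebra.TensorProduct.map ψ (AlgHom.id ℂ (subI Q))
          ((Algebra.TensorProduct.assoc ℂ ℂ ℂ (Osp Q) (Osp Q) (subI Q)).symm
            (Algebra.TensorProduct.map (AlgHom.id ℂ (Osp Q)) (legHom Q b')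
              (legHom Q b (casI Q)))) = uniformChain Q S p) ∧
      (∀ S : Finset ℕ, uniformChain Q S m =
          Algebra.TensorProduct.map D (AlgHom.id ℂ (subI Q)) (comulI Q (casI Q)) →
        (∀ k ≤ p, m < k → k ∈ S) → ψ (comul Q (casimir Q)) = uniformCas Q S p) ∧
      (∀ S : Finset ℕ, uniformChain Q S m = 1 ⊗ₜ casI Q →
        (∀ k ≤ p, m < k → k ∈ S) → ψ (1 ⊗ₜ casimir Q) = uniformCas Q S p) ∧
      (∀ S : Finset ℕ, S.Nonempty → (∀ k ∈ S, k ≤ m) → Gam Q m S = D (casimir Q) →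
        ψ (casimir Q ⊗ₜ 1) = Gam Q p S) := by
  induction p, h using Nat.le_induction with
  | base =>
    refine ⟨(tensorPowSucc Q m).toAlgHom.comp
      (Algebra.TensorProduct.map D (AlgHom.id ℂ (Osp Q))), fun S b b' hS hb => ?_,
      fun S hS h => ?_, fun S hS h => ?_, fun S hne hS h => ?_⟩
    · rw [uniformChain, hS, hb _ le_rfl (by omega)]
      induction legHom Q b (casI Q) using TensorProduct.induction_on with
      | zero => simp only [map_zero]
      | tmul x d =>
        simp only [Algebra.TensorProduct.map_tmul, AlgHom.coe_id, id_eq, lastLeg_tmul]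
        induction legHom Q b' d using TensorProduct.induction_on with
        | zero => simp only [tmul_zero, map_zero]
        | tmul y e => rfl
        | add x y hx hy => simp only [tmul_add, map_add, hx, hy]
      | add x y hx hy => simp only [map_add, hx, hy]
    · rw [uniformCas, hS, ← coe_casI, ← inclI_comulI]
      induction comulI Q (casI Q) using TensorProduct.induction_on with
      | zero => simp only [map_zero]
      | tmul x d => rfl
      | add x y hx hy => simp only [map_add, hx, hy]
    · rw [uniformCas, hS, AlgHom.comp_apply, Algebra.TensorProduct.map_tmul, map_one]
      rfl
    · rw [Gam_succ Q S m hne hS, h, AlgHom.comp_apply, Algebra.TensorProduct.map_tmul, map_one]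
      rfl
  | succ p hp ih =>
    obtain ⟨ψ, h1, h2, h3, h4⟩ := ih
    obtain ⟨p, rfl⟩ := Nat.exists_eq_succ_of_ne_zero (show p ≠ 0 by omega)
    refine ⟨(comulLast Q p).comp ψ, fun S b b' hS hb => ?_,
      fun S hS h => ?_, fun S hS h => ?_, fun S hne hS h => ?_⟩
    · rw [uniformChain_succ_succ, ← h1 S b b' hS fun k hk => hb k (by omega), comulPenultimate,
        ← AlgHom.comp_apply (Algebra.TensorProduct.map (comulLast Q p) _),
        ← Algebra.TensorProduct.map_comp]
      · rfl
      · rw [hb _ (by omega) (by omega), hb _ (by omega) (by omega)]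
    · rw [uniformCas_succ_succ Q S p (h _ (by omega) (by omega)),
        ← h2 S hS fun k hk => h k (by omega)]
      rfl
    · rw [uniformCas_succ_succ Q S p (h _ (by omega) (by omega)),
        ← h3 S hS fun k hk => h k (by omega)]
      rfl
    · rw [AlgHom.comp_apply, h4 S hne hS h,
        Gam_succ Q S (p + 1) hne fun k hk => (hS k hk).trans (by omega),
        Gam_succ Q S p hne fun k hk => (hS k hk).trans (by omega), comulLast_succ, map_one]
      rfl

end uniformChain

/-! ### The morphism from three legs to `n` legs. -/

section threeBlocks
variable (Q : QParam)

open TensorProduct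

theorem exists_threeBlocks {a m j n : ℕ} (ham : a < m) (hmj : m < j) {T : Finset ℕ}
    (hT : T.Nonempty) (hjT : ∀ k ∈ T, j < k) (hTn : ∀ k ∈ T, k ≤ n) :
    ∃ H : Osp Q ⊗[ℂ] (Osp Q ⊗[ℂ] subI Q) →ₐ[ℂ] TensorPow Q n,
      (∀ S : Finset ℕ, (∀ k, k ∈ S ↔ a < k ∧ k ≤ j) → H (cas12 Q) = Gam Q n S) ∧
      (∀ S : Finset ℕ, (∀ k, k ∈ S ↔ m < k ∧ k ≤ j ∨ k ∈ T) → H (cas23 Q) = Gam Q n S) ∧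
      (∀ S : Finset ℕ, (∀ k, k ∈ S ↔ a < k ∧ k ≤ m ∨ k ∈ T) → H (cas13 Q) = Gam Q n S) ∧
      (∀ S : Finset ℕ, (∀ k, k ∈ S ↔ a < k ∧ k ≤ j ∨ k ∈ T) → H (cas123 Q) = Gam Q n S) ∧
      (∀ S : Finset ℕ, (∀ k, k ∈ S ↔ a < k ∧ k ≤ m) → H (cas1 Q) = Gam Q n S) ∧
      (∀ S : Finset ℕ, (∀ k, k ∈ S ↔ m < k ∧ k ≤ j) → H (cas2 Q) = Gam Q n S) ∧
      H (cas3 Q) = Gam Q n T := by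
  -- The leg in `𝓘` has to end at the position `max T = r + 1`, behind `r` full legs; from there on
  -- only units follow.
  obtain ⟨r, hr⟩ : ∃ r, T.max' hT = r + 1 :=
    Nat.exists_eq_succ_of_ne_zero (by have := hjT _ (T.max'_mem hT); omega)
  have hrT : r + 1 ∈ T := hr ▸ T.max'_mem hT
  have hTr : ∀ k ∈ T, k ≤ r + 1 := fun k hk => hr ▸ T.le_max' k hk
  have hjr : j ≤ r := by have := hjT _ hrT; omega
  obtain ⟨D, hD⟩ := exists_block Q (show a + 1 ≤ m from ham)
  obtain ⟨ψ, h1, h2, h3, h4⟩ := exists_twoBlocks Q (show m + 1 ≤ j from hmj) D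
  obtain ⟨F, hF, hF'⟩ := exists_extension Q T hjr
  obtain ⟨E, hE⟩ := exists_padding Q (hTn _ hrT)
  -- `b` and `b'` record whether `S` contains the first and the second block. The four sets that
  -- contain `T` correspond to the four pairs `(b, b')`.
  have key : ∀ (S : Finset ℕ) (b b' : Bool), (∀ k ≤ a, 1 ≤ k → k ∉ S) →
      (∀ k ≤ m, a < k → decide (k ∈ S) = b) → (∀ k ≤ j, m < k → decide (k ∈ S) = b') →
      (∀ k, j < k → (k ∈ S ↔ k ∈ T)) →
      E (inclLast Q r (F (Algebra.TensorProduct.map ψ (AlgHom.id ℂ (subI Q))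
          ((Algebra.TensorProduct.assoc ℂ ℂ ℂ (Osp Q) (Osp Q) (subI Q)).symm
            (Algebra.TensorProduct.map (AlgHom.id ℂ (Osp Q)) (legHom Q b')
              (legHom Q b (casI Q))))))) = Gam Q n S := by
    intro S b b' ha hb hb' hk
    have hS : ∀ k ∈ S, k ≤ r + 1 := by
      intro k hkS
      rcases le_or_gt k j with h | h
      · omega
      · exact hTr k ((hk k h).1 hkS)
    have hrS : r + 1 ∈ S := (hk _ (by omega)).2 hrT
    rw [h1 S b b' ((hD S ha).1 b hb) hb', hF S fun k _ => hk k, ← Gam_eq_inclLast Q S r hrS hS,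
      hE S ⟨_, hrS⟩ hS]
  -- The remaining three Casimirs involve only the first two blocks and have a unit in the leg of
  -- `𝓘`.
  have key' : ∀ S : Finset ℕ, S.Nonempty → (∀ k ∈ S, k ≤ j) →
      E (inclLast Q r (F (Gam Q j S ⊗ₜ 1))) = Gam Q n S := by
    intro S hne hS
    rw [hF' S hne hS, inclLast_tmul, OneMemClass.coe_one,
      ← Gam_succ Q S r hne fun k hk => (hS k hk).trans hjr,
      hE S hne fun k hk => (hS k hk).trans (by omega)]
  refine ⟨(E.comp ((inclLast Q r).comp F)).comp
    ((Algebra.TensorProduct.map ψ (AlgHom.id ℂ (subI Q))).comp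
      (Algebra.TensorProduct.assoc ℂ ℂ ℂ (Osp Q) (Osp Q) (subI Q)).symm.toAlgHom),
    fun S hS => ?_, fun S hS => ?_, fun S hS => ?_, fun S hS => ?_, fun S hS => ?_,
    fun S hS => ?_, ?_⟩
  · have hjS : j ∈ S := (hS j).2 (by omega)
    have hle : ∀ k ∈ S, k ≤ j := fun k hk => ((hS k).1 hk).2
    have hc : ∀ k ≤ a, 1 ≤ k → k ∉ S := fun k hk _ h => by have := (hS k).1 h; omega
    rw [← key' S ⟨_, hjS⟩ hle, Gam_eq_uniformCas Q S (by omega) hjS hle,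
      ← h2 S ((hD S hc).1 true fun k hk hk' => decide_eq_true ((hS k).2 (by omega)))
        fun k hk hk' => (hS k).2 (by omega)]
    simp only [AlgHom.comp_apply, cas12]
    erw [AlgEquiv.symm_apply_apply]
    rfl
  · rw [← key S false true]
    -- A missing first block is treated as a hole: `τ(Γ) = 1 ⊗ Γ` turns `(1 ⊗ Δ) τ(Γ)` into `1 ⊗
    -- Δ(Γ)`.
    · have e : cas23 Q = Algebra.TensorProduct.map (AlgHom.id ℂ (Osp Q)) (legHom Q true)
          (legHom Q false (casI Q)) := by
        change _ = Algebra.TensorProduct.map (AlgHom.id ℂ (Osp Q)) (comulI Q) (tau Q (casI Q))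
        rw [tau_casimir]; rfl
      rw [e]; rfl
    · exact fun k hk _ h => ((hS k).1 h).elim (by omega) fun h => by have := hjT k h; omega
    · exact fun k hk _ => decide_eq_false fun h =>
        ((hS k).1 h).elim (by omega) fun h => by have := hjT k h; omega
    · exact fun k hk hk' => decide_eq_true ((hS k).2 (Or.inl ⟨hk', hk⟩))
    · exact fun k hk => ⟨fun h => ((hS k).1 h).resolve_left (by omega), fun h => (hS k).2 (.inr h)⟩
  · rw [← key S true false]
    · rfl
    · exact fun k hk _ h => ((hS k).1 h).elim (by omega) fun h => by have := hjT k h; omega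
    · exact fun k hk hk' => decide_eq_true ((hS k).2 (Or.inl ⟨hk', hk⟩))
    · exact fun k hk _ => decide_eq_false fun h =>
        ((hS k).1 h).elim (by omega) fun h => by have := hjT k h; omega
    · exact fun k hk => ⟨fun h => ((hS k).1 h).resolve_left (by omega), fun h => (hS k).2 (.inr h)⟩
  · rw [← key S true true]
    · rfl
    · exact fun k hk _ h => ((hS k).1 h).elim (by omega) fun h => by have := hjT k h; omega
    · exact fun k hk hk' => decide_eq_true ((hS k).2 (Or.inl (by omega)))
    · exact fun k hk hk' => decide_eq_true ((hS k).2 (Or.inl (by omega)))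
    · exact fun k hk => ⟨fun h => ((hS k).1 h).resolve_left (by omega), fun h => (hS k).2 (.inr h)⟩
  · have hmS : m ∈ S := (hS m).2 (by omega)
    have hle : ∀ k ∈ S, k ≤ m := fun k hk => ((hS k).1 hk).2
    have hc : ∀ k ≤ a, 1 ≤ k → k ∉ S := fun k hk _ h => by have := (hS k).1 h; omega
    rw [← key' S ⟨_, hmS⟩ fun k hk => (hle k hk).trans hmj.le, ← h4 S ⟨_, hmS⟩ hle]
    · rfl
    · rw [Gam_eq_uniformCas Q S (by omega) hmS hle, (hD S hc).2 fun k hk hk' => (hS k).2 ⟨hk', hk⟩]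
  · have hjS : j ∈ S := (hS j).2 (by omega)
    have hle : ∀ k ∈ S, k ≤ j := fun k hk => ((hS k).1 hk).2
    rw [← key' S ⟨_, hjS⟩ hle, Gam_eq_uniformCas Q S (by omega) hjS hle, ← h3 S]
    · rfl
    · exact uniformChain_of_notMem Q S m fun k hk _ h => by have := (hS k).1 h; omega
    · exact fun k hk hk' => (hS k).2 ⟨hk', hk⟩
  · rw [← key T false false]
    · have e : cas3 Q = Algebra.TensorProduct.map (AlgHom.id ℂ (Osp Q)) (legHom Q false)
          (legHom Q false (casI Q)) := by
        change _ = Algebra.TensorProduct.map (AlgHom.id ℂ (Osp Q)) (tau Q) (tau Q (casI Q))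
        rw [tau_casimir, Algebra.TensorProduct.map_tmul, tau_casimir]; rfl
      rw [e]; rfl
    · exact fun k hk _ h => by have := hjT k h; omega
    · exact fun k hk _ => decide_eq_false fun h => by have := hjT k h; omega
    · exact fun k hk _ => decide_eq_false fun h => by have := hjT k h; omega
    · exact fun k _ => Iff.rfl

end threeBlocks
end QBI

/-! ### The block decomposition of a matching pair. -/

open QBI in
theorem theorem2p3 (Q : QParam) (n : ℕ) (A B C : Finset ℕ)
    (hA : A ⊆ Finset.Icc 1 n) (hB : B ⊆ Finset.Icc 1 n)
    (hmatch : Matches A B) (hcons : ∃ i j : ℕ, A = Finset.Icc i j)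
    (hC : C = (A ∪ B) \ (A ∩ B)) :
    GenerateQBannaiIto Q (Gam Q n A) (Gam Q n B) (Gam Q n C)
      ((Q.s + Q.s⁻¹) • (Gam Q n (A ∩ B) * Gam Q n (A ∪ B) +
        Gam Q n (A \ (A ∩ B)) * Gam Q n (B \ (A ∩ B))))
      ((Q.s + Q.s⁻¹) • (Gam Q n (B ∩ C) * Gam Q n (B ∪ C) +
        Gam Q n (B \ (B ∩ C)) * Gam Q n (C \ (B ∩ C))))
      ((Q.s + Q.s⁻¹) • (Gam Q n (C ∩ A) * Gam Q n (C ∪ A) +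
        Gam Q n (C \ (C ∩ A)) * Gam Q n (A \ (C ∩ A)))) := by
  obtain ⟨i, j, hij⟩ := hcons
  obtain ⟨h₁, h₂, h₃, hlt, hlt'⟩ := hmatch
  have memA : ∀ k, k ∈ A ↔ i ≤ k ∧ k ≤ j := fun k => by rw [hij, Finset.mem_Icc]
  have memC : ∀ k, k ∈ C ↔ (k ∈ A ∨ k ∈ B) ∧ ¬ (k ∈ A ∧ k ∈ B) := fun k => by
    rw [hC, Finset.mem_sdiff, Finset.mem_union, Finset.mem_inter]
  have hlow : ∀ x ∈ A, x ∉ B → ∀ y ∈ A, y ∈ B → x < y := fun x hx hx' y hy hy' =>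
    (Finset.le_max' _ x (by simp [hx, hx'])).trans_lt
      (hlt.trans_le (Finset.min'_le _ y (by simp [hy, hy'])))
  have hhigh : ∀ x ∈ A, x ∈ B → ∀ y ∈ B, y ∉ A → x < y := fun x hx hx' y hy hy' =>
    (Finset.le_max' _ x (by simp [hx, hx'])).trans_lt
      (hlt'.trans_le (Finset.min'_le _ y (by simp [hy, hy'])))
  obtain ⟨x, hx⟩ := h₁
  obtain ⟨y, hy⟩ := h₂
  simp only [Finset.mem_sdiff, Finset.mem_inter, not_and] at hx hy
  have hxB := hx.2 hx.1
  have hij' : i ≤ j := ((memA x).1 hx.1).1.trans ((memA x).1 hx.1).2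
  have hi : 1 ≤ i := (Finset.mem_Icc.1 (hA ((memA i).2 ⟨le_rfl, hij'⟩))).1
  have hjA : j ∈ A := (memA j).2 ⟨hij', le_rfl⟩
  -- If the top element of `A` were outside `B`, it would lie below an element `y` of `A ∩ B`,
  -- although `y ≤ j`.
  have hjB : j ∈ B := by
    by_contra h
    have := hlow j hjA h y hy.1 hy.2
    have := (memA y).1 hy.1
    omega
  -- The blocks become the half-open intervals `(a, m]` and `(m, j]`, with `m = max (A \ B)`; the
  -- shift is legitimate because positions start at 1.
  obtain ⟨a, rfl⟩ : ∃ a, i = a + 1 := ⟨i - 1, by omega⟩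
  obtain ⟨m, hm⟩ : ∃ m, (A \ B).max' ⟨x, by simp [hx.1, hxB]⟩ = m := ⟨_, rfl⟩
  have hmAB : m ∈ A \ B := hm ▸ Finset.max'_mem _ _
  rw [Finset.mem_sdiff] at hmAB
  have hmmax : ∀ k ∈ A, k ∉ B → k ≤ m := fun k hk hk' =>
    hm ▸ Finset.le_max' _ k (by simp [hk, hk'])
  have hma := (memA m).1 hmAB.1
  have hmj : m < j := hlow m hmAB.1 hmAB.2 j hjA hjB
  have memB : ∀ k ∈ A, (k ∈ B ↔ m < k) := fun k hk =>
    ⟨hlow m hmAB.1 hmAB.2 k hk, fun h => by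
      by_contra h'
      exact absurd (hmmax k hk h') (by omega)⟩
  have memD : ∀ k, k ∈ B \ (A ∩ B) ↔ k ∈ B ∧ k ∉ A := fun k => by
    simp only [Finset.mem_sdiff, Finset.mem_inter]; tauto
  have hDj : ∀ k ∈ B \ (A ∩ B), j < k := fun k hk =>
    hhigh j hjA hjB k ((memD k).1 hk).1 ((memD k).1 hk).2
  have hDn : ∀ k ∈ B \ (A ∩ B), k ≤ n := fun k hk =>
    (Finset.mem_Icc.1 (hB ((memD k).1 hk).1)).2
  have hB' : ∀ k, k ∈ B ↔ m < k ∧ k ≤ j ∨ k ∈ B \ (A ∩ B) := fun k => by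
    rw [memD]; clear * - memA memB hma; grind
  have hC' : ∀ k, k ∈ C ↔ a < k ∧ k ≤ m ∨ k ∈ B \ (A ∩ B) := fun k => by
    rw [memD, memC]; clear * - memA memB hma; grind
  have hAB : ∀ k, k ∈ A ∪ B ↔ a < k ∧ k ≤ j ∨ k ∈ B \ (A ∩ B) := fun k => by
    rw [memD, Finset.mem_union]; clear * - memA; grind
  have hAdB : ∀ k, k ∈ A \ (A ∩ B) ↔ a < k ∧ k ≤ m := fun k => by
    rw [Finset.mem_sdiff, Finset.mem_inter]; clear * - memA memB hma; grind
  have hAiB : ∀ k, k ∈ A ∩ B ↔ m < k ∧ k ≤ j := fun k => by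
    rw [Finset.mem_inter]; clear * - memA memB hma; grind
  obtain ⟨H, H12, H23, H13, H123, H1, H2, H3⟩ :=
    exists_threeBlocks Q (show a < m by omega) hmj h₃ hDj hDn
  -- The cyclic relations are stated with intersections and differences that involve `C`; each of
  -- these is one of the three blocks, and each union is that of all three.
  have sBC : B ∩ C = B \ (A ∩ B) := by
    ext k; simp only [Finset.mem_inter, Finset.mem_sdiff, memC]; tauto
  have sBC' : B ∪ C = A ∪ B := by
    ext k; simp only [Finset.mem_union, memC]; tauto
  have sB : B \ (B ∩ C) = A ∩ B := by
    ext k; simp only [Finset.mem_inter, Finset.mem_sdiff, memC]; tauto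
  have sC : C \ (B ∩ C) = A \ (A ∩ B) := by
    ext k; simp only [Finset.mem_inter, Finset.mem_sdiff, memC]; tauto
  have sCA : C ∩ A = A \ (A ∩ B) := by
    ext k; simp only [Finset.mem_inter, Finset.mem_sdiff, memC]; tauto
  have sCA' : C ∪ A = A ∪ B := by
    ext k; simp only [Finset.mem_union, memC]; tauto
  have sC' : C \ (C ∩ A) = B \ (A ∩ B) := by
    ext k; simp only [Finset.mem_inter, Finset.mem_sdiff, memC]; tauto
  have sA : A \ (C ∩ A) = A ∩ B := by
    ext k; simp only [Finset.mem_inter, Finset.mem_sdiff, memC]; tauto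
  have key := (generateQBannaiIto_threeLegs Q).map Q H
  simp only [map_add, map_smul, map_mul] at key
  rw [H12 A memA, H23 B hB', H13 C hC', H123 _ hAB, H1 _ hAdB, H2 _ hAiB, H3] at key
  rwa [sB, sC, sBC, sBC', sC', sA, sCA, sCA']
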